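/- **Setting.** Let $F(x)=\mathbb E_{\xi\sim\nu}[f(x;\xi)]$ on $\mathbb R^d$, where $f(\cdot;\xi)$ is differentiable, and let $F$ be differentiable, bounded from below, with $\|\nabla F(x)-\nabla F(x')\|\le L\|x-x'\|$ for all $x,x'$ ($L>0$). A stochastic first-order oracle returns $\nabla f(x;\xi)$ for a fresh independent sample $\xi\sim\nu$. Fix $p\in(1,2]$. *Nonlinearity.* $\Psi:\mathbb R^d\to\mathbb R^d$ satisfies $\|\Psi(x)\|\le C$ for all $x$ ($C>0$) and, for some $K>0$, has one of the following two forms. - Component-wise, $\Psi(x)=(\psi(x_1),\dots,\psi(x_d))$, where $\psi$ is $C^2$, odd, non-decreasing, strictly increasing on some interval $(-c,c)$ with $c>0$, $|\psi'|\le K$, and $\psi''$ is bounded. - Joint, $\Psi(x)=\varphi(\|x\|)\,x$, where $\varphi$ is $C^1$, positive and non-increasing on $(0,\infty)$, $r\mapsto r\varphi(r)$ is non-decreasing on $(0,\infty)$, and the operator norm of $\varphi'(\|x\|)\frac{xx^\top}{\|x\|}+\varphi(\|x\|)I$ is at most $K$ for all $x\ne0$. *Method (N-MSGE).* Given a deterministic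 $x^1$, a reference point $y$, $a>0$, step sizes $\alpha_t=a/\sqrt{t+1}$ and batch sizes $B_t=\lceil t^{p/(2(p-1))}\rceil$, put, for $t\ge1$, $$x^{t+1}=x^t-\alpha_t\Psi\Big(\nabla f(x^t;\xi^t_1)-\nabla f(y;\xi^t_2)+\frac1{B_t}\sum_{j=1}^{B_t}\nabla f(y;\xi^t_{j+2})\Big),$$ where the samples $\xi^t_j\sim\nu$ are i.i.d. Iteration $t$ makes $B_t+2$ oracle calls. *Noise.* Let $z^t_1=\nabla f(x^t;\xi^t_1)-\nabla F(x^t)$ and $z^t_j=\nabla f(y;\xi^t_j)-\nabla F(y)$ for $2\le j\le B_t+2$. In each iteration $t$ the vectors $z^t_1,\dots,z^t_{B_t+2}$ are i.i.d. with density $P$, and the family $(z^t_j)_j$ is independent of $(x^1,\dots,x^t)$. For some $E_0>0$ and all $\|x\|\le E_0$ the set $\{u: P(u)>0,\ P(u-x)>0\}$ has positive Lebesgue measure. Moreover $\mathbb E[z^t_j]=0$ and $\mathbb E\|z^t_j\|^p\le\sigma^p$ ($\sigma>0$). *Constants.* Let $\Phi(v)=\mathbb E[\Psi(v+z_1-z_2)]$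 with $z_1,z_2$ independent of density $P$. Let $\gamma_1,\gamma_2>0$ be constants with $\langle\Phi(v),v\rangle\ge\min\{\gamma_1\|v\|,\gamma_2\|v\|^2\}$ for all $v\in\mathbb R^d$. **Statement.** Such constants $\gamma_1,\gamma_2>0$ exist for every $\Psi$ and $P$ as above. For any such pair, suppose that $$a\le\min\Big\{1,\ \frac{\gamma_2}{1+8C^2},\ \frac{\frac12\gamma_1}{(1+8C^2)\big(LC+\frac12\|\nabla F(x^1)\|\big)}\Big\}$$ and $F(x^1)-\inf F\le\Delta$. Then, up to a logarithmic factor, N-MSGE reaches an $\epsilon$-stationary point with high probability within $\mathcal O\big(\epsilon^{-\frac{6p-4}{p-1}}\big)$ oracle calls in total. Precisely, for every $\epsilon_0>0$ there is a constant $A>0$, depending only on $p,\sigma,C,K,L,\Delta,a,\gamma_1,\gamma_2$ and $\epsilon_0$, such that for all $\epsilon\in(0,\epsilon_0]$ and $\delta\in(0,1)$ there is a number of iterations $T$ with $$\sum_{t=1}^{T}(B_t+2)\ \le\ A\,\epsilon^{-\frac{6p-4}{p-1}}\,\Big(\log\big(2+\tfrac1{\epsilon\delta}\big)\Big)^{\frac{3p-2}{p-1}}\quad\text{and}\quad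 \mathbb P\Big(\min_{1\le k\le T}\|\nabla F(x^k)\|\le\epsilon\Big)\ \ge\ 1-\delta .$$ -/

import Mathlib

open MeasureTheory ProbabilityTheory

noncomputable section

namespace NMSGE

/-- The Euclidean space `ℝ^d`. -/
abbrev Vec (d : ℕ) := EuclideanSpace ℝ (Fin d)

/-- `F` is differentiable, bounded from below, and has an `L`-Lipschitz gradient. -/
structure SmoothCost {d : ℕ} (F : Vec d → ℝ) (L : ℝ) : Prop where
  differentiable : Differentiable ℝ F
  bddBelow : BddBelow (Set.range F)
  lipschitz : ∀ x y, ‖gradient F x - gradient F y‖ ≤ L * ‖x - y‖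

/-- `Ψ x = (ψ x₁, …, ψ x_d)` for a smooth, odd, non-decreasing scalar map `ψ` which is strictly
increasing around the origin, with `|ψ'| ≤ K` and `ψ''` bounded. -/
def IsComponentwise {d : ℕ} (Ψ : Vec d → Vec d) (K : ℝ) : Prop :=
  ∃ ψ : ℝ → ℝ,
    (∀ x i, Ψ x i = ψ (x i)) ∧
    ContDiff ℝ 2 ψ ∧
    Monotone ψ ∧
    (∀ u, ψ (-u) = -ψ u) ∧
    (∃ c > 0, StrictMonoOn ψ (Set.Ioo (-c) c)) ∧
    (∀ u, |deriv ψ u| ≤ K) ∧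
    (∃ K₂ > 0, ∀ u, |deriv (deriv ψ) u| ≤ K₂)

/-- `Ψ x = φ(‖x‖) x` with `φ` continuously differentiable, positive and non-increasing on `(0, ∞)`,
`r ↦ r φ(r)` non-decreasing on `(0, ∞)`, and with the Jacobian
`φ'(‖x‖) x xᵀ / ‖x‖ + φ(‖x‖) I` of operator norm at most `K`. -/
def IsJoint {d : ℕ} (Ψ : Vec d → Vec d) (K : ℝ) : Prop :=
  ∃ φ : ℝ → ℝ,
    (∀ x, Ψ x = φ ‖x‖ • x) ∧
    ContDiff ℝ 1 φ ∧
    MonotoneOn (fun r => r * φ r) (Set.Ioi 0) ∧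
    AntitoneOn φ (Set.Ioi 0) ∧
    (∀ r, 0 < r → 0 < φ r) ∧
    (∀ x : Vec d, x ≠ 0 →
      ‖(deriv φ ‖x‖ / ‖x‖) • InnerProductSpace.rankOne ℝ x x
        + φ ‖x‖ • ContinuousLinearMap.id ℝ (Vec d)‖ ≤ K)

/-- The smooth nonlinearities: component-wise or joint, with values bounded by `C` and derivative
bounded by `K`. -/
structure SmoothNonlinearity {d : ℕ} (Ψ : Vec d → Vec d) (C K : ℝ) : Prop where
  form : IsComponentwise Ψ K ∨ IsJoint Ψ K
  bounded : ∀ x, ‖Ψ x‖ ≤ C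

/-- The measure on `ℝ^d` with Lebesgue density `P`. -/
def noiseLaw {d : ℕ} (P : Vec d → ℝ) : Measure (Vec d) :=
  volume.withDensity fun z => ENNReal.ofReal (P z)

/-- `P` is a probability density, `{y | P y > 0 and P (y - x) > 0}` has positive Lebesgue measure
for all `x` in some ball around the origin, and the noise is centred, with `p`-th moment at most
`σ ^ p`. -/
structure NoiseDensity {d : ℕ} (P : Vec d → ℝ) (p σ : ℝ) : Prop where
  measurable : Measurable P
  nonneg : ∀ z, 0 ≤ P z
  total : noiseLaw P Set.univ = 1
  overlap : ∃ E₀ > 0, ∀ x, ‖x‖ ≤ E₀ → 0 < volume {y | 0 < P y ∧ 0 < P (y - x)}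
  moment : ∫⁻ z, ENNReal.ofReal (‖z‖ ^ p) ∂noiseLaw P ≤ ENNReal.ofReal (σ ^ p)
  centred : ∫ z, z ∂noiseLaw P = 0

/-- The denoised nonlinearity `Φ(y) = 𝔼[Ψ(y + z₁ - z₂)]`, with `z₁, z₂` independent of density
`P`. -/
def denoised {d : ℕ} (Ψ : Vec d → Vec d) (P : Vec d → ℝ) (y : Vec d) : Vec d :=
  ∫ w, Ψ (y + (w.1 - w.2)) ∂(noiseLaw P).prod (noiseLaw P)

/-- `⟪Φ(y), y⟫ ≥ min {γ₁ ‖y‖, γ₂ ‖y‖²}` for all `y`: the property that specifies the constants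
`γ₁, γ₂` of the pair (nonlinearity, noise). -/
def IsDescentPair {d : ℕ} (Ψ : Vec d → Vec d) (P : Vec d → ℝ) (γ₁ γ₂ : ℝ) : Prop :=
  ∀ y, min (γ₁ * ‖y‖) (γ₂ * ‖y‖ ^ 2) ≤ inner ℝ (denoised Ψ P y) y

/-- The batch size `B_t = t ^ (p / (2 (p - 1)))`, rounded up. -/
def batchSize (p : ℝ) (t : ℕ) : ℕ := ⌈(t : ℝ) ^ (p / (2 * (p - 1)))⌉₊

/-- The step size `α_t = a / (t + 1) ^ η`. -/
def stepSize (a η : ℝ) (t : ℕ) : ℝ := a / ((t : ℝ) + 1) ^ η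

/-- The largest admissible step-size parameter; `G` is the gradient norm at the initial model. -/
def maxStep (η γ₁ γ₂ C L G : ℝ) : ℝ :=
  min 1 (min (γ₂ / (1 + 8 * C ^ 2))
    ((1 - η) * γ₁ / ((1 + 8 * C ^ 2) * (L * C + (1 - η) * G))))

/-- Iteration `t` makes `B_t + 2` oracle calls; this is their number in iterations `1, …, T`. -/
def oracleCalls (p : ℝ) (T : ℕ) : ℕ := ∑ t ∈ Finset.Icc 1 T, (batchSize p t + 2)

/-- The answer `∇f(x; s)` of the stochastic first-order oracle. -/
def oracle {d : ℕ} {Ξ : Type*} (f : Vec d → Ξ → ℝ) (x : Vec d) (s : Ξ) : Vec d :=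
  gradient (fun x' => f x' s) x

/-- The mini-batch symmetrized gradient estimator
`∇f(x; s₁) - ∇f(y; s₂) + B⁻¹ ∑_{j = 1}^{B} ∇f(y; s_{j + 2})`. -/
def msge {d : ℕ} {Ξ : Type*} (f : Vec d → Ξ → ℝ) (y : Vec d) (B : ℕ) (x : Vec d) (s : ℕ → Ξ) :
    Vec d :=
  oracle f x (s 1) - oracle f y (s 2)
    + (B : ℝ)⁻¹ • ∑ j ∈ Finset.Icc 1 B, oracle f y (s (j + 2))

/-- The gradient noise of the `j`-th oracle call of an iteration: the first call is made at the
current model `x`, the others at the reference point `y`. -/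
def gradNoise {d : ℕ} {Ξ : Type*} (f : Vec d → Ξ → ℝ) (F : Vec d → ℝ) (y x : Vec d) (s : ℕ → Ξ)
    (j : ℕ) : Vec d :=
  if j = 1 then oracle f x (s 1) - gradient F x else oracle f y (s j) - gradient F y

/-- The stochastic optimization problem `F(x) = 𝔼[f(x; ξ)]`, with `ξ ∼ ν`. -/
structure IsPopulationCost {d : ℕ} {Ξ : Type*} [MeasurableSpace Ξ] (f : Vec d → Ξ → ℝ)
    (ν : Measure Ξ) (F : Vec d → ℝ) : Prop where
  differentiable : ∀ s, Differentiable ℝ fun x => f x s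
  integrable : ∀ x, Integrable (f x) ν
  eq_integral : ∀ x, F x = ∫ s, f x s ∂ν

/-- The samples `ξ_j^t` are independent, with common law `ν`. -/
structure IIDSamples {Ω Ξ : Type*} [MeasurableSpace Ω] [MeasurableSpace Ξ] (μ : Measure Ω)
    (ν : Measure Ξ) (ξ : ℕ → ℕ → Ω → Ξ) : Prop where
  measurable : ∀ t j, Measurable (ξ t j)
  law : ∀ t j, μ.map (ξ t j) = ν
  indep : iIndepFun (fun i : ℕ × ℕ => ξ i.1 i.2) μ

/-- `x 1, x 2, …` are the models generated by the method, started at `x₁`, with reference point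
`y`, step-size parameters `a, η` and batch sizes `batchSize p`. -/
structure IsRun {d : ℕ} {Ω Ξ : Type*} (f : Vec d → Ξ → ℝ) (Ψ : Vec d → Vec d) (p a η : ℝ)
    (x₁ y : Vec d) (ξ : ℕ → ℕ → Ω → Ξ) (x : ℕ → Ω → Vec d) : Prop where
  init : ∀ ω, x 1 ω = x₁
  step : ∀ t, 1 ≤ t → ∀ ω, x (t + 1) ω
    = x t ω - stepSize a η t • Ψ (msge f y (batchSize p t) (x t ω) fun j => ξ t j ω)

/-- In each iteration `t`, the noise vectors `z_1^t, …, z_{B_t + 2}^t` are independent, with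
density `P`, and the noise is independent of the models `x 1, …, x t` found so far. -/
structure IIDNoise {d : ℕ} {Ω Ξ : Type*} [MeasurableSpace Ω] (μ : Measure Ω)
    (f : Vec d → Ξ → ℝ) (F : Vec d → ℝ) (P : Vec d → ℝ) (p : ℝ) (y : Vec d)
    (ξ : ℕ → ℕ → Ω → Ξ) (x : ℕ → Ω → Vec d) : Prop where
  law : ∀ t, 1 ≤ t → ∀ j ∈ Finset.Icc 1 (batchSize p t + 2),
    μ.map (fun ω => gradNoise f F y (x t ω) (fun i => ξ t i ω) j) = noiseLaw P
  indep : ∀ t, 1 ≤ t →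
    iIndepFun (fun (j : Finset.Icc 1 (batchSize p t + 2)) ω =>
      gradNoise f F y (x t ω) (fun i => ξ t i ω) j) μ
  indep_past : ∀ t, 1 ≤ t →
    IndepFun (fun ω (k : Finset.Icc 1 t) => x k ω)
      (fun ω (j : Finset.Icc 1 (batchSize p t + 2)) =>
        gradNoise f F y (x t ω) (fun i => ξ t i ω) j) μ

end NMSGE

end

noncomputable section

namespace NMSGE

/-! ### Descent constants from the monotonicity of the nonlinearity -/

section

variable {d : ℕ}

/-! Symmetrization and the boundedness of Ψ tame the heavy tails. Up to the batch average, an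
iteration moves along Ψ(∇F(x) + z₁ - z₂), whose mean is Φ(∇F(x)). The difference z₁ - z₂ is
symmetric and charges every nonempty open set in some ball around 0. Hence averaging the odd
monotone Ψ gives an odd monotone Φ which grows at least linearly along rays near 0, and this yields
γ₁ and γ₂ (`exists_isDescentPair_of_monotone`).

The batch average has only a p-th moment, but Ψ is K-Lipschitz, so only its mean norm matters.
Truncation bounds this norm by 3σ B^(-(p-1)/p) (`NoiseDensity.integral_norm_average_le`), and the
choice of B_t makes that O(t^(-1/2)).

High probability comes from an exponential supermartingale. Since Ψ is bounded, Hoeffding's lemma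
costs only α²C²‖∇F‖²/2 in the exponent. Bounded steps let ‖∇F(x^t)‖ grow at most like √t, so
α_t‖∇F(x^t)‖ stays bounded, and the condition on a lets half of the descent absorb this cost. What
remains is the squared bias and the smoothness term, both O(1/t), with sum O(log T). Thus the
exponential of the cost increase, plus half of the descent, minus these errors, has expectation at
most 1 (`IsRun.lintegral_exp_potential_le`).

If no model up to time T is ε-stationary, that exponent is at least of order ε²√T, less Δ and O(log
T). Markov's inequality makes this unlikely once T is of order ε^(-4) log². Multiplying T by the
largest batch size T^(p/(2(p-1))) gives the number of oracle calls. -/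

theorem NoiseDensity.isProbabilityMeasure {P : Vec d → ℝ} {p σ : ℝ} (hP : NoiseDensity P p σ) :
    IsProbabilityMeasure (noiseLaw P) := ⟨hP.total⟩

/-- The difference of two independent noise vectors charges every nonempty open set near `0`. -/
theorem NoiseDensity.sub_mem_pos {P : Vec d → ℝ} {p σ : ℝ} (hP : NoiseDensity P p σ) {E₀ : ℝ}
    (hE : ∀ x, ‖x‖ ≤ E₀ → 0 < volume {y | 0 < P y ∧ 0 < P (y - x)})
    {U : Set (Vec d)} (hU : IsOpen U) (hne : U.Nonempty) (hUE : ∀ x ∈ U, ‖x‖ ≤ E₀) :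
    0 < (noiseLaw P).prod (noiseLaw P) {w | w.1 - w.2 ∈ U} := by
  have hPm := hP.measurable
  have hdm : Measurable fun z => ENNReal.ofReal (P z) := hPm.ennreal_ofReal
  have := hP.isProbabilityMeasure
  rw [pos_iff_ne_zero]
  intro h0
  unfold noiseLaw at h0
  have : SFinite ((volume : Measure (Vec d)).withDensity fun z => ENNReal.ofReal (P z)) :=
    inferInstanceAs (SFinite (noiseLaw P))
  rw [prod_withDensity hdm hdm, withDensity_apply_eq_zero' (by fun_prop)] at h0
  -- The volume-preserving shear (x, a) ↦ (a + x, a) turns the difference of the two noise vectors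
  -- into the first coordinate, so that Fubini can isolate a single difference x.
  have hmp := Measure.measurePreserving_swap.comp
    (measurePreserving_prod_add (volume : Measure (Vec d)) (volume : Measure (Vec d)))
  have hmp2 := hmp.comp (Measure.measurePreserving_swap (μ := (volume : Measure (Vec d)))
    (ν := (volume : Measure (Vec d))))
  have h1 := hmp2.quasiMeasurePreserving.preimage_null h0
  have h2 := Measure.ae_ae_of_ae_prod (measure_eq_zero_iff_ae_notMem.mp h1)
  obtain ⟨x, hxU, hx⟩ : ∃ x ∈ U, ∀ᵐ a : Vec d,
      (x, a) ∉ ((Prod.swap ∘ fun z : Vec d × Vec d => (z.1, z.1 + z.2)) ∘ Prod.swap) ⁻¹'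
        ({x | ENNReal.ofReal (P x.1) * ENNReal.ofReal (P x.2) ≠ 0} ∩ {w | w.1 - w.2 ∈ U}) := by
    by_contra! hcon
    have : volume U ≤ 0 := by
      refine (measure_mono ?_).trans (le_of_eq h2)
      intro x hx
      exact hcon x hx
    exact (hU.measure_pos volume hne).not_ge this
  -- The fibre over x is where P(a) and P(a + x) are both positive, which is the overlap set for -x.
  have hneg := hE (-x) (by rw [norm_neg]; exact hUE x hxU)
  refine hneg.ne' (measure_mono_null ?_ hx)
  rintro a ⟨ha1, ha2⟩
  simp only [Set.mem_compl_iff, Set.mem_ofPred_eq, not_not, Set.mem_preimage, Function.comp,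
    Prod.swap, Set.mem_inter_iff]
  rw [sub_neg_eq_add] at ha2
  refine ⟨?_, by simpa using hxU⟩
  simp [ha1, ha2]

section denoised

variable {Ψ : Vec d → Vec d} {P : Vec d → ℝ} {p σ C : ℝ}

theorem integrable_denoised (hΨ : Continuous Ψ) (hb : ∀ x, ‖Ψ x‖ ≤ C) (hP : NoiseDensity P p σ)
    (v : Vec d) :
    Integrable (fun w : Vec d × Vec d => Ψ (v + (w.1 - w.2)))
      ((noiseLaw P).prod (noiseLaw P)) := by
  have := hP.isProbabilityMeasure
  exact Integrable.of_bound (hΨ.comp (by fun_prop)).aestronglyMeasurable C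
    (Filter.Eventually.of_forall fun w => hb _)

theorem denoised_neg (hP : NoiseDensity P p σ) (hodd : ∀ x, Ψ (-x) = -Ψ x) (v : Vec d) :
    denoised Ψ P (-v) = -denoised Ψ P v := by
  have := hP.isProbabilityMeasure
  unfold denoised
  rw [← integral_prod_swap, ← integral_neg]
  refine integral_congr_ae (Filter.Eventually.of_forall fun w => ?_)
  simp only [Prod.fst_swap, Prod.snd_swap]
  rw [← hodd]
  congr 1
  abel

theorem inner_denoised_sub (hΨ : Continuous Ψ) (hb : ∀ x, ‖Ψ x‖ ≤ C) (hP : NoiseDensity P p σ)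
    (u v h : Vec d) :
    inner ℝ (denoised Ψ P u - denoised Ψ P v) h
      = ∫ w, inner ℝ (Ψ (u + (w.1 - w.2)) - Ψ (v + (w.1 - w.2))) h
          ∂(noiseLaw P).prod (noiseLaw P) := by
  have hu := integrable_denoised hΨ hb hP u
  have hv := integrable_denoised hΨ hb hP v
  unfold denoised
  have huv : Integrable (fun w : Vec d × Vec d => Ψ (u + (w.1 - w.2)) - Ψ (v + (w.1 - w.2)))
      ((noiseLaw P).prod (noiseLaw P)) := hu.sub hv
  rw [← integral_sub hu hv, real_inner_comm, ← integral_inner huv]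
  simp only [real_inner_comm h]

/-- A bounded, continuous, odd and monotone map which is strongly monotone on balls arbitrarily
close to the origin admits descent constants for every noise density. -/
theorem exists_isDescentPair_of_monotone (hΨ : Continuous Ψ) (hb : ∀ x, ‖Ψ x‖ ≤ C)
    (hP : NoiseDensity P p σ) (hodd : ∀ x, Ψ (-x) = -Ψ x)
    (hmono : ∀ x y, 0 ≤ inner ℝ (Ψ x - Ψ y) (x - y))
    (hstrong : ∀ E > 0, ∃ w₀ : Vec d, ‖w₀‖ < E ∧ ∃ ρ > 0, ∃ κ > 0, ∀ x y,
      ‖x - w₀‖ < ρ → ‖y - w₀‖ < ρ → κ * ‖x - y‖ ^ 2 ≤ inner ℝ (Ψ x - Ψ y) (x - y)) :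
    ∃ g₁ > 0, ∃ g₂ > 0, IsDescentPair Ψ P g₁ g₂ := by
  have := hP.isProbabilityMeasure
  obtain ⟨E, hE0, hE⟩ := hP.overlap
  obtain ⟨w₀, hw₀, ρ, hρ, κ, hκ, hloc⟩ := hstrong E hE0
  have hΦmono : ∀ u v, 0 ≤ inner ℝ (denoised Ψ P u - denoised Ψ P v) (u - v) := by
    intro u v
    rw [inner_denoised_sub hΨ hb hP]
    refine integral_nonneg fun w => ?_
    have := hmono (u + (w.1 - w.2)) (v + (w.1 - w.2))
    simpa using this
  set U : Set (Vec d) := Metric.ball w₀ (ρ / 2) ∩ Metric.ball 0 E with hUdef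
  have hUo : IsOpen U := Metric.isOpen_ball.inter Metric.isOpen_ball
  have hpos := hP.sub_mem_pos hE hUo
    ⟨w₀, by simpa [hUdef, hρ] using hw₀⟩ (fun x hx => by simpa using (Metric.mem_ball.1 hx.2).le)
  set S : Set (Vec d × Vec d) := {w | w.1 - w.2 ∈ U} with hS
  have hSm : MeasurableSet S := hUo.measurableSet.preimage (by fun_prop)
  set q := ((noiseLaw P).prod (noiseLaw P)).real S with hq
  have hq0 : 0 < q := by
    rw [hq, measureReal_def]
    exact ENNReal.toReal_pos hpos.ne' (measure_ne_top _ _)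
  have hsmall : ∀ v, ‖v‖ < ρ / 2 → κ * q * ‖v‖ ^ 2 ≤ inner ℝ (denoised Ψ P v) v := by
    intro v hv
    -- Oddness turns ⟪Φ(v), v⟫ into a monotonicity gap between v and -v. Whenever z₁ - z₂ lies
    -- within ρ/2 of w₀, both shifted points lie in the ball of radius ρ where Ψ is strongly
    -- monotone; elsewhere the integrand is nonnegative.
    have h1 : 4 * inner ℝ (denoised Ψ P v) v
        = inner ℝ (denoised Ψ P v - denoised Ψ P (-v)) (v - -v) := by
      rw [denoised_neg hP hodd, sub_neg_eq_add, sub_neg_eq_add, inner_add_left, inner_add_right]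
      ring
    have h2 : κ * (4 * ‖v‖ ^ 2) * q
        ≤ inner ℝ (denoised Ψ P v - denoised Ψ P (-v)) (v - -v) := by
      rw [inner_denoised_sub hΨ hb hP]
      calc κ * (4 * ‖v‖ ^ 2) * q
          = ∫ w, S.indicator (fun _ => κ * (4 * ‖v‖ ^ 2)) w
              ∂(noiseLaw P).prod (noiseLaw P) := by
            rw [integral_indicator_const _ hSm, smul_eq_mul, mul_comm]
        _ ≤ _ := by
            refine integral_mono ((integrable_const _).indicator hSm) ?_ fun w => ?_
            · exact ((integrable_denoised hΨ hb hP v).sub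
                (integrable_denoised hΨ hb hP (-v))).inner_const _
            · by_cases hw : w ∈ S
              · rw [Set.indicator_of_mem hw]
                have hwb : ‖w.1 - w.2 - w₀‖ < ρ / 2 := by
                  simpa [dist_eq_norm] using Metric.mem_ball.1 hw.1
                have h3 := hloc (v + (w.1 - w.2)) (-v + (w.1 - w.2))
                  (by
                    rw [add_sub_assoc]
                    exact (norm_add_le _ _).trans_lt (by linarith))
                  (by
                    rw [add_sub_assoc]
                    exact (norm_add_le _ _).trans_lt (by rw [norm_neg]; linarith))
                rw [add_sub_add_right_eq_sub] at h3
                have h4 : ‖v - -v‖ ^ 2 = 4 * ‖v‖ ^ 2 := by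
                  rw [sub_neg_eq_add, ← two_smul ℝ, norm_smul]
                  norm_num
                  ring
                rwa [h4] at h3
              · rw [Set.indicator_of_notMem hw]
                have := hmono (v + (w.1 - w.2)) (-v + (w.1 - w.2))
                rwa [add_sub_add_right_eq_sub] at this
    nlinarith
  refine ⟨κ * q * (ρ / 4), by positivity, κ * q, by positivity, fun v => ?_⟩
  rcases lt_or_ge ‖v‖ (ρ / 2) with hv | hv
  · exact (min_le_right _ _).trans (hsmall v hv)
  · refine (min_le_left _ _).trans ?_
    have hv0 : 0 < ‖v‖ := by linarith
    -- Far from the origin, monotonicity of Φ along the ray through v compares v with its rescaling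
    -- to norm ρ/4, where the quadratic bound holds. This gives linear growth with slope κqρ/4.
    set s := ρ / 4 / ‖v‖ with hs
    have hs0 : 0 < s := by positivity
    have hsv : s * ‖v‖ = ρ / 4 := by rw [hs]; field_simp
    have hs1 : s < 1 := by rw [hs, div_lt_one hv0]; linarith
    have hnorm : ‖s • v‖ = ρ / 4 := by rw [norm_smul, Real.norm_of_nonneg hs0.le, hsv]
    have h5 := hsmall (s • v) (by rw [hnorm]; linarith)
    rw [hnorm, inner_smul_right] at h5
    have h6 := hΦmono v (s • v)
    have h7 : v - s • v = (1 - s) • v := by rw [sub_smul, one_smul]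
    rw [h7, inner_smul_right, inner_sub_left] at h6
    have h8 := nonneg_of_mul_nonneg_right h6 (by linarith)
    have h9 : s * (κ * q * (ρ / 4) * ‖v‖) ≤ s * inner ℝ (denoised Ψ P (s • v)) v := by
      refine le_trans (le_of_eq ?_) h5
      rw [← hsv]
      ring
    linarith [le_of_mul_le_mul_left h9 hs0]

end denoised

end

/-! ### Lipschitz continuity and monotonicity of the two forms of Ψ -/

section

variable {d : ℕ} {Ψ : Vec d → Vec d} {K : ℝ}

section componentwise

theorem IsComponentwise.lipschitz (h : IsComponentwise Ψ K) (hK : 0 ≤ K) (x y : Vec d) :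
    ‖Ψ x - Ψ y‖ ≤ K * ‖x - y‖ := by
  obtain ⟨ψ, hψ, hC2, -, -, -, hd, -⟩ := h
  have hdiff : Differentiable ℝ ψ := hC2.differentiable (by norm_num)
  have hl : ∀ a b, |ψ a - ψ b| ≤ K * |a - b| := fun a b =>
    convex_univ.norm_image_sub_le_of_norm_deriv_le (fun z _ => hdiff z) (fun z _ => hd z)
      (Set.mem_univ b) (Set.mem_univ a)
  refine le_of_sq_le_sq ?_ (by positivity)
  rw [mul_pow, EuclideanSpace.norm_sq_eq, EuclideanSpace.norm_sq_eq, Finset.mul_sum]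
  refine Finset.sum_le_sum fun i _ => ?_
  rw [← mul_pow]
  simp only [PiLp.sub_apply, hψ]
  exact pow_le_pow_left₀ (norm_nonneg _) (hl _ _) 2

theorem IsComponentwise.odd (h : IsComponentwise Ψ K) (x : Vec d) : Ψ (-x) = -Ψ x := by
  obtain ⟨ψ, hψ, -, -, hodd, -⟩ := h
  ext i
  simp [hψ, hodd]

theorem IsComponentwise.monotone (h : IsComponentwise Ψ K) (x y : Vec d) :
    0 ≤ inner ℝ (Ψ x - Ψ y) (x - y) := by
  obtain ⟨ψ, hψ, -, hm, -⟩ := h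
  rw [PiLp.inner_apply]
  refine Finset.sum_nonneg fun i _ => ?_
  simp only [PiLp.sub_apply, hψ, RCLike.inner_apply, conj_trivial]
  rcases le_total (x i) (y i) with hxy | hxy
  · exact mul_nonneg_of_nonpos_of_nonpos (sub_nonpos.2 hxy) (sub_nonpos.2 (hm hxy))
  · exact mul_nonneg (sub_nonneg.2 hxy) (sub_nonneg.2 (hm hxy))

/-- Strict monotonicity does not exclude ψ'(0) = 0, so the ball need not be centred at 0. The mean
value theorem gives ψ'(s₀) > 0 at some s₀ arbitrarily close to 0, and w₀ = (s₀, …, s₀) works by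
continuity of ψ'. -/
theorem IsComponentwise.exists_strongly_monotone (h : IsComponentwise Ψ K) (E : ℝ) (hE : 0 < E) :
    ∃ w₀ : Vec d, ‖w₀‖ < E ∧ ∃ ρ > 0, ∃ κ > 0, ∀ x y,
      ‖x - w₀‖ < ρ → ‖y - w₀‖ < ρ → κ * ‖x - y‖ ^ 2 ≤ inner ℝ (Ψ x - Ψ y) (x - y) := by
  obtain ⟨ψ, hψ, hC2, -, -, ⟨c, hc, hstrict⟩, -⟩ := h
  have hdiff : Differentiable ℝ ψ := hC2.differentiable (by norm_num)
  have hdc : Continuous (deriv ψ) := hC2.continuous_deriv (by norm_num)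
  have hd1 : (0 : ℝ) < (d : ℝ) + 1 := by positivity
  obtain ⟨r, hr0, hrc, hrE⟩ : ∃ r > 0, r < c ∧ r * (d + 1) < E := by
    refine ⟨min c (E / (d + 1)) / 2, by positivity, ?_, ?_⟩
    · have : min c (E / (d + 1)) ≤ c := min_le_left _ _
      linarith
    · have : min c (E / (d + 1)) ≤ E / (d + 1) := min_le_right _ _
      have h2 : min c (E / (d + 1)) * (d + 1) ≤ E := (le_div_iff₀ hd1).1 this
      nlinarith
  obtain ⟨s₀, hs₀, hslope⟩ := exists_deriv_eq_slope ψ hr0 hdiff.continuous.continuousOn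
    hdiff.differentiableOn
  have hpos : 0 < deriv ψ s₀ := by
    rw [hslope]
    have := hstrict (a := 0) (b := r) ⟨by linarith, by linarith⟩ ⟨by linarith, by linarith⟩ hr0
    exact div_pos (by linarith) (by linarith)
  obtain ⟨ρ, hρ, hball⟩ : ∃ ρ > 0, ∀ u, |u - s₀| < ρ → deriv ψ s₀ / 2 < deriv ψ u := by
    have := hdc.continuousAt.eventually_const_lt (show deriv ψ s₀ / 2 < deriv ψ s₀ by linarith)
    obtain ⟨ρ, hρ, hb⟩ := Metric.eventually_nhds_iff.1 this
    exact ⟨ρ, hρ, fun u hu => hb (by rwa [Real.dist_eq])⟩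
  have hconv : ∀ u v, |u - s₀| < ρ → |v - s₀| < ρ → u ≤ v →
      deriv ψ s₀ / 2 * (v - u) ≤ ψ v - ψ u := by
    intro u v hu hv huv
    have hmem : ∀ w, |w - s₀| < ρ ↔ w ∈ Metric.ball s₀ ρ := fun w => by
      rw [Metric.mem_ball, Real.dist_eq]
    refine (convex_ball s₀ ρ).mul_sub_le_image_sub_of_le_deriv hdiff.continuous.continuousOn
      hdiff.differentiableOn ?_ u ((hmem u).1 hu) v ((hmem v).1 hv) huv
    intro w hw
    rw [Metric.isOpen_ball.interior_eq] at hw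
    exact (hball w ((hmem w).2 hw)).le
  refine ⟨WithLp.toLp 2 fun _ => s₀, ?_, ρ, hρ, deriv ψ s₀ / 2, by positivity, ?_⟩
  · refine lt_of_le_of_lt (le_of_sq_le_sq (b := r * (d + 1)) ?_ (by positivity)) hrE
    rw [EuclideanSpace.norm_sq_eq]
    simp only [Real.norm_eq_abs, sq_abs, Finset.sum_const, Finset.card_univ, Fintype.card_fin,
      nsmul_eq_mul]
    have h1 : s₀ ^ 2 ≤ r ^ 2 := pow_le_pow_left₀ hs₀.1.le hs₀.2.le 2
    have h2 : (d : ℝ) ≤ (d + 1) ^ 2 := by nlinarith [(Nat.cast_nonneg d : (0 : ℝ) ≤ d)]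
    calc (d : ℝ) * s₀ ^ 2 ≤ (d + 1) ^ 2 * r ^ 2 := mul_le_mul h2 h1 (sq_nonneg _) (by positivity)
      _ = (r * (d + 1)) ^ 2 := by ring
  · intro x y hx hy
    rw [PiLp.inner_apply, EuclideanSpace.norm_sq_eq, Finset.mul_sum]
    refine Finset.sum_le_sum fun i _ => ?_
    have hx' : |x i - s₀| < ρ := by
      have := (PiLp.norm_apply_le (x - WithLp.toLp 2 fun _ => s₀) i).trans_lt hx
      simpa using this
    have hy' : |y i - s₀| < ρ := by
      have := (PiLp.norm_apply_le (y - WithLp.toLp 2 fun _ => s₀) i).trans_lt hy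
      simpa using this
    simp only [PiLp.sub_apply, hψ, RCLike.inner_apply, conj_trivial, Real.norm_eq_abs, sq_abs]
    rcases le_total (x i) (y i) with hxy | hxy
    · nlinarith [hconv _ _ hx' hy' hxy]
    · nlinarith [hconv _ _ hy' hx' hxy]

end componentwise

section joint

/-- A continuous radial profile, positive and non-increasing on `(0, ∞)`, is positive at `0`. -/
theorem radial_zero_pos {φ : ℝ → ℝ} (hφ : Continuous φ) (hanti : AntitoneOn φ (Set.Ioi 0))
    (hpos : ∀ r, 0 < r → 0 < φ r) : 0 < φ 0 := by
  refine (hpos 1 one_pos).trans_le ?_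
  have ht : Filter.Tendsto φ (nhdsWithin 0 (Set.Ioi 0)) (nhds (φ 0)) :=
    hφ.continuousAt.tendsto.mono_left nhdsWithin_le_nhds
  refine ge_of_tendsto ht ?_
  filter_upwards [Ioo_mem_nhdsGT (zero_lt_one (α := ℝ))] with r hr
  exact hanti hr.1 (Set.mem_Ioi.2 one_pos) hr.2.le

theorem IsJoint.odd (h : IsJoint Ψ K) (x : Vec d) : Ψ (-x) = -Ψ x := by
  obtain ⟨φ, hΨ, -⟩ := h
  rw [hΨ, hΨ, norm_neg, smul_neg]

/-- The inner product equals (‖x‖φ(‖x‖) - ‖y‖φ(‖y‖))(‖x‖ - ‖y‖) + (φ(‖x‖) + φ(‖y‖))(‖x‖‖y‖ - ⟪x,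
y⟫). The first term is nonnegative because rφ(r) is non-decreasing, the second by Cauchy-Schwarz. -/
theorem IsJoint.monotone (h : IsJoint Ψ K) (x y : Vec d) :
    0 ≤ inner ℝ (Ψ x - Ψ y) (x - y) := by
  obtain ⟨φ, hΨ, hφ, hmono, hanti, hpos, -⟩ := h
  have h0 := radial_zero_pos hφ.continuous hanti hpos
  have hnn : ∀ r, 0 ≤ r → 0 ≤ φ r := fun r hr => by
    rcases hr.eq_or_lt with rfl | hr
    exacts [h0.le, (hpos r hr).le]
  have hm : ∀ a b, 0 ≤ a → a ≤ b → a * φ a ≤ b * φ b := by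
    intro a b ha hab
    rcases ha.eq_or_lt with rfl | ha'
    · rw [zero_mul]
      exact mul_nonneg hab (hnn b hab)
    · exact hmono ha' (ha'.trans_le hab) hab
  have hm' : 0 ≤ (‖x‖ * φ ‖x‖ - ‖y‖ * φ ‖y‖) * (‖x‖ - ‖y‖) := by
    rcases le_total ‖x‖ ‖y‖ with hxy | hxy
    · exact mul_nonneg_of_nonpos_of_nonpos (sub_nonpos.2 (hm _ _ (norm_nonneg _) hxy))
        (sub_nonpos.2 hxy)
    · exact mul_nonneg (sub_nonneg.2 (hm _ _ (norm_nonneg _) hxy)) (sub_nonneg.2 hxy)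
  rw [hΨ, hΨ]
  simp only [inner_sub_left, inner_sub_right, inner_smul_left, real_inner_self_eq_norm_sq,
    conj_trivial, real_inner_comm x y]
  have hxy := real_inner_le_norm x y
  have hs : 0 ≤ φ ‖x‖ + φ ‖y‖ := add_nonneg (hnn _ (norm_nonneg _)) (hnn _ (norm_nonneg _))
  nlinarith [mul_le_mul_of_nonneg_left hxy hs]

/-- Near 0, Ψ is φ(0) times the identity plus a perturbation. As φ is locally Lipschitz, the
perturbation has Lipschitz constant at most φ(0)/2 on a small ball. -/
theorem IsJoint.exists_strongly_monotone (h : IsJoint Ψ K) :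
    ∃ ρ > 0, ∃ κ > 0, ∀ x y,
      ‖x‖ < ρ → ‖y‖ < ρ → κ * ‖x - y‖ ^ 2 ≤ inner ℝ (Ψ x - Ψ y) (x - y) := by
  obtain ⟨φ, hΨ, hφ, -, hanti, hpos, -⟩ := h
  have h0 := radial_zero_pos hφ.continuous hanti hpos
  obtain ⟨M, t, ht, hLip⟩ := (hφ.contDiffAt (x := 0)).exists_lipschitzOnWith
  obtain ⟨r, hr, hrt⟩ := Metric.mem_nhds_iff.1 ht
  have hM : (0 : ℝ) ≤ M := M.2
  set ρ := min r (φ 0 / (4 * (M + 1))) with hρ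
  have hρ0 : 0 < ρ := by positivity
  have hMρ : 2 * (M * ρ) ≤ φ 0 / 2 := by
    have h1 : ρ * (4 * (M + 1)) ≤ φ 0 :=
      (le_div_iff₀ (by positivity)).1 (min_le_right r (φ 0 / (4 * (M + 1))))
    nlinarith
  refine ⟨ρ, hρ0, φ 0 / 2, by positivity, fun x y hx hy => ?_⟩
  have hmem : ∀ z : Vec d, ‖z‖ < ρ → ‖z‖ ∈ t := fun z hz => hrt (by
    rw [Metric.mem_ball, Real.dist_eq, sub_zero, abs_norm]
    exact hz.trans_le (min_le_left _ _))
  have hl : ∀ a ∈ t, ∀ b ∈ t, |φ a - φ b| ≤ M * |a - b| := fun a ha b hb => by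
    simpa [Real.dist_eq] using hLip.dist_le_mul a ha b hb
  have h1 : |φ ‖x‖ - φ 0| ≤ M * ρ := by
    refine (hl _ (hmem x hx) 0 (mem_of_mem_nhds ht)).trans ?_
    rw [sub_zero, abs_norm]
    exact mul_le_mul_of_nonneg_left hx.le hM
  have h2 : |φ ‖x‖ - φ ‖y‖| ≤ M * ‖x - y‖ := by
    refine (hl _ (hmem x hx) _ (hmem y hy)).trans ?_
    exact mul_le_mul_of_nonneg_left (abs_norm_sub_norm_le x y) hM
  have h3 : Ψ x - Ψ y
      = φ 0 • (x - y) + ((φ ‖x‖ - φ 0) • (x - y) + (φ ‖x‖ - φ ‖y‖) • y) := by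
    rw [hΨ, hΨ]
    module
  have h4 : ‖(φ ‖x‖ - φ 0) • (x - y) + (φ ‖x‖ - φ ‖y‖) • y‖ ≤ φ 0 / 2 * ‖x - y‖ := by
    refine (norm_add_le _ _).trans ?_
    rw [norm_smul, norm_smul, Real.norm_eq_abs, Real.norm_eq_abs]
    have h5 : |φ ‖x‖ - φ ‖y‖| * ‖y‖ ≤ M * ‖x - y‖ * ρ :=
      mul_le_mul h2 hy.le (norm_nonneg _) (by positivity)
    nlinarith [mul_le_mul_of_nonneg_right h1 (norm_nonneg (x - y)), norm_nonneg (x - y)]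
  rw [h3, inner_add_left, inner_smul_left, real_inner_self_eq_norm_sq, conj_trivial]
  have h6 := (abs_le.1 (abs_real_inner_le_norm
    ((φ ‖x‖ - φ 0) • (x - y) + (φ ‖x‖ - φ ‖y‖) • y) (x - y))).1
  nlinarith [mul_le_mul_of_nonneg_right h4 (norm_nonneg (x - y))]

theorem IsJoint.lipschitz (h : IsJoint Ψ K) (x y : Vec d) : ‖Ψ x - Ψ y‖ ≤ K * ‖x - y‖ := by
  obtain ⟨φ, hΨ, hφ, -, hanti, hpos, hJ⟩ := h
  rcases subsingleton_or_nontrivial (Vec d) with hs | hs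
  · simp [Subsingleton.elim x y]
  have h0 := radial_zero_pos hφ.continuous hanti hpos
  have hφd : Differentiable ℝ φ := hφ.differentiable one_ne_zero
  have hΨ' : Ψ = fun x => φ ‖x‖ • x := funext hΨ
  set J : Vec d → Vec d →L[ℝ] Vec d := fun x =>
    (deriv φ ‖x‖ / ‖x‖) • InnerProductSpace.rankOne ℝ x x
        + φ ‖x‖ • ContinuousLinearMap.id ℝ (Vec d) with hJdef
  have hder : ∀ z : Vec d, HasFDerivAt Ψ (J z) z := by
    intro z
    rcases eq_or_ne z 0 with rfl | hz
    · have hJ0 : J 0 = φ 0 • ContinuousLinearMap.id ℝ (Vec d) := by simp [hJdef]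
      rw [hJ0, hasFDerivAt_iff_isLittleO_nhds_zero]
      have hc : Filter.Tendsto (fun v : Vec d => φ ‖v‖ - φ 0) (nhds 0) (nhds 0) := by
        have hcc : Continuous fun v : Vec d => φ ‖v‖ - φ 0 :=
          (hφ.continuous.comp continuous_norm).sub continuous_const
        simpa using hcc.tendsto 0
      have ho := ((Asymptotics.isLittleO_one_iff ℝ).2 hc).smul_isBigO
        (Asymptotics.isBigO_refl (fun v : Vec d => v) (nhds 0))
      simp only [one_smul] at ho
      refine ho.congr_left fun v => ?_
      simp [hΨ, sub_smul]
    · have hn : HasFDerivAt (fun v : Vec d => ‖v‖) ((1 / ‖z‖) • innerSL ℝ z) z := by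
        have h1 := (hasStrictFDerivAt_norm_sq z).hasFDerivAt.sqrt
          (pow_ne_zero 2 (norm_ne_zero_iff.2 hz))
        simp only [Real.sqrt_sq (norm_nonneg _)] at h1
        refine h1.congr_fderiv ?_
        ext v
        simp
        ring
      have h2 : HasFDerivAt (fun v : Vec d => φ ‖v‖) (deriv φ ‖z‖ • ((1 / ‖z‖) • innerSL ℝ z)) z :=
        (hφd ‖z‖).hasDerivAt.comp_hasFDerivAt z hn
      rw [hΨ']
      refine (h2.smul (hasFDerivAt_id z)).congr_fderiv ?_
      ext v i
      simp [hJdef]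
      ring
  -- The Jacobian bound is assumed only away from 0. There z is an eigenvector of the Jacobian with
  -- eigenvalue rφ'(r) + φ(r), r = ‖z‖, which tends to φ(0) as r → 0.
  have hφ0 : φ 0 ≤ K := by
    obtain ⟨e, he⟩ := exists_ne (0 : Vec d)
    have hlim : Filter.Tendsto (fun r : ℝ => r * deriv φ r + φ r) (nhdsWithin 0 (Set.Ioi 0))
        (nhds (φ 0)) := by
      have : Continuous fun r : ℝ => r * deriv φ r + φ r :=
        (continuous_id.mul (hφ.continuous_deriv le_rfl)).add hφ.continuous
      have h1 := (this.tendsto 0).mono_left (nhdsWithin_le_nhds (s := Set.Ioi 0))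
      simpa using h1
    refine le_of_tendsto hlim ?_
    filter_upwards [self_mem_nhdsWithin] with r hr
    have hr : 0 < r := hr
    set z : Vec d := (r / ‖e‖) • e with hz
    have he0 : 0 < ‖e‖ := norm_pos_iff.2 he
    have hzn : ‖z‖ = r := by
      rw [hz, norm_smul, Real.norm_of_nonneg (by positivity)]
      field_simp
    have hz0 : z ≠ 0 := by
      rw [← norm_pos_iff, hzn]
      exact hr
    have hJz : J z z = (r * deriv φ r + φ r) • z := by
      simp only [hJdef, add_apply, smul_apply,
        InnerProductSpace.rankOne_apply, real_inner_self_eq_norm_sq, hzn,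
        ContinuousLinearMap.id_apply, smul_smul, ← add_smul]
      congr 1
      field_simp
    have h1 := (J z).le_of_opNorm_le (hJ z hz0) z
    rw [hJz, norm_smul, hzn] at h1
    exact (le_abs_self _).trans (le_of_mul_le_mul_right h1 hr)
  refine convex_univ.norm_image_sub_le_of_norm_hasFDerivWithin_le
    (fun z _ => (hder z).hasFDerivWithinAt) (fun z _ => ?_) (Set.mem_univ y) (Set.mem_univ x)
  rcases eq_or_ne z 0 with rfl | hz
  · have hJ0 : J 0 = φ 0 • ContinuousLinearMap.id ℝ (Vec d) := by simp [hJdef]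
    rw [hJ0, norm_smul, Real.norm_of_nonneg h0.le, ContinuousLinearMap.norm_id, mul_one]
    exact hφ0
  · exact hJ z hz

end joint

theorem SmoothNonlinearity.lipschitz {C : ℝ} (h : SmoothNonlinearity Ψ C K) (hK : 0 ≤ K)
    (x y : Vec d) : ‖Ψ x - Ψ y‖ ≤ K * ‖x - y‖ := by
  rcases h.form with h | h
  exacts [h.lipschitz hK x y, h.lipschitz x y]

theorem SmoothNonlinearity.continuous {C : ℝ} (h : SmoothNonlinearity Ψ C K) (hK : 0 ≤ K) :
    Continuous Ψ :=
  (LipschitzWith.of_dist_le_mul (K := ⟨K, hK⟩) fun x y => by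
    rw [dist_eq_norm, dist_eq_norm]
    exact h.lipschitz hK x y).continuous

theorem SmoothNonlinearity.exists_isDescentPair {C p σ : ℝ} {P : Vec d → ℝ}
    (h : SmoothNonlinearity Ψ C K) (hK : 0 ≤ K) (hP : NoiseDensity P p σ) :
    ∃ g₁ > 0, ∃ g₂ > 0, IsDescentPair Ψ P g₁ g₂ := by
  have hc := h.continuous hK
  rcases h.form with hΨ | hΨ
  · exact exists_isDescentPair_of_monotone hc h.bounded hP hΨ.odd hΨ.monotone
      hΨ.exists_strongly_monotone
  · refine exists_isDescentPair_of_monotone hc h.bounded hP hΨ.odd hΨ.monotone fun E hE => ?_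
    obtain ⟨ρ, hρ, κ, hκ, hs⟩ := hΨ.exists_strongly_monotone
    exact ⟨0, by simpa using hE, ρ, hρ, κ, hκ, by simpa using hs⟩

end

/-! ### Truncation and the mean of a heavy-tailed batch -/

section

variable {d : ℕ} {P : Vec d → ℝ} {p σ : ℝ}

section truncation

/-- The part of `z` inside the ball of radius `τ`. -/
def truncIn (τ : ℝ) (z : Vec d) : Vec d := Set.indicator {z | ‖z‖ ≤ τ} id z

/-- The part of `z` outside the ball of radius `τ`. -/
def truncOut (τ : ℝ) (z : Vec d) : Vec d := Set.indicator {z | ‖z‖ ≤ τ}ᶜ id z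

theorem truncIn_add_truncOut (τ : ℝ) (z : Vec d) : truncIn τ z + truncOut τ z = z :=
  Set.indicator_self_add_compl_apply _ _ _

theorem measurable_truncIn (τ : ℝ) : Measurable (truncIn (d := d) τ) :=
  measurable_id.indicator (measurableSet_le measurable_norm measurable_const)

theorem measurable_truncOut (τ : ℝ) : Measurable (truncOut (d := d) τ) :=
  measurable_id.indicator (measurableSet_le measurable_norm measurable_const).compl

theorem norm_truncIn_le {τ : ℝ} (hτ : 0 ≤ τ) (z : Vec d) : ‖truncIn τ z‖ ≤ τ := by
  unfold truncIn
  by_cases hz : ‖z‖ ≤ τ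
  · rwa [Set.indicator_of_mem (by exact hz)]
  · rwa [Set.indicator_of_notMem (by exact hz), norm_zero]

theorem norm_truncIn_sq_le {τ : ℝ} (hτ : 0 < τ) (hp2 : p ≤ 2) (z : Vec d) :
    ‖truncIn τ z‖ ^ 2 ≤ τ ^ (2 - p) * ‖z‖ ^ p := by
  have h0 : 0 ≤ τ ^ (2 - p) * ‖z‖ ^ p := by positivity
  unfold truncIn
  by_cases hz : ‖z‖ ≤ τ
  · rw [Set.indicator_of_mem (by exact hz), id]
    rcases (norm_nonneg z).eq_or_lt with hz0 | hz0
    · rw [← hz0] at h0 ⊢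
      simpa using h0
    · calc ‖z‖ ^ 2 = ‖z‖ ^ (2 - p) * ‖z‖ ^ p := by
            rw [← Real.rpow_add hz0, sub_add_cancel, Real.rpow_two]
        _ ≤ _ := by gcongr
  · rw [Set.indicator_of_notMem (by exact hz), norm_zero]
    simpa using h0

theorem norm_truncOut_le {τ : ℝ} (hτ : 0 < τ) (hp : 1 < p) (z : Vec d) :
    ‖truncOut τ z‖ ≤ τ ^ (1 - p) * ‖z‖ ^ p := by
  have h0 : 0 ≤ τ ^ (1 - p) * ‖z‖ ^ p := by positivity
  unfold truncOut
  by_cases hz : ‖z‖ ≤ τ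
  · rw [Set.indicator_of_notMem (by simpa using hz), norm_zero]
    exact h0
  · rw [Set.indicator_of_mem (by simpa using hz), id]
    have hz0 : 0 < ‖z‖ := by linarith
    calc ‖z‖ = ‖z‖ ^ (1 - p) * ‖z‖ ^ p := by
          rw [← Real.rpow_add hz0, sub_add_cancel, Real.rpow_one]
      _ ≤ _ := mul_le_mul_of_nonneg_right
          (Real.rpow_le_rpow_of_nonpos hτ (not_le.1 hz).le (by linarith)) (by positivity)

theorem NoiseDensity.integrable_norm_rpow (hP : NoiseDensity P p σ) :
    Integrable (fun z => ‖z‖ ^ p) (noiseLaw P) := by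
  refine ⟨(measurable_norm.pow_const p).aestronglyMeasurable, ?_⟩
  rw [hasFiniteIntegral_iff_ofReal (Filter.Eventually.of_forall fun z => by positivity)]
  exact hP.moment.trans_lt ENNReal.ofReal_lt_top

theorem NoiseDensity.integral_norm_rpow_le (hP : NoiseDensity P p σ) (hσ : 0 < σ) :
    ∫ z, ‖z‖ ^ p ∂noiseLaw P ≤ σ ^ p := by
  rw [integral_eq_lintegral_of_nonneg_ae (Filter.Eventually.of_forall fun z => by positivity)
    (measurable_norm.pow_const p).aestronglyMeasurable]
  exact ENNReal.toReal_le_of_le_ofReal (by positivity) hP.moment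

theorem NoiseDensity.integrable_truncIn (hP : NoiseDensity P p σ) {τ : ℝ} (hτ : 0 < τ) :
    Integrable (truncIn τ) (noiseLaw P) := by
  have := hP.isProbabilityMeasure
  exact Integrable.of_bound (measurable_truncIn τ).aestronglyMeasurable τ
    (Filter.Eventually.of_forall fun z => norm_truncIn_le hτ.le z)

theorem NoiseDensity.integrable_truncOut (hP : NoiseDensity P p σ) (hp : 1 < p) {τ : ℝ}
    (hτ : 0 < τ) : Integrable (truncOut τ) (noiseLaw P) :=
  (hP.integrable_norm_rpow.const_mul (τ ^ (1 - p))).mono'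
    (measurable_truncOut τ).aestronglyMeasurable
    (Filter.Eventually.of_forall fun z => norm_truncOut_le hτ hp z)

theorem NoiseDensity.integral_truncIn_sq_le (hP : NoiseDensity P p σ) (hσ : 0 < σ) (hp2 : p ≤ 2)
    {τ : ℝ} (hτ : 0 < τ) :
    ∫ z, ‖truncIn τ z‖ ^ 2 ∂noiseLaw P ≤ τ ^ (2 - p) * σ ^ p := by
  calc ∫ z, ‖truncIn τ z‖ ^ 2 ∂noiseLaw P
      ≤ ∫ z, τ ^ (2 - p) * ‖z‖ ^ p ∂noiseLaw P :=
        integral_mono_of_nonneg (Filter.Eventually.of_forall fun z => by positivity)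
          (hP.integrable_norm_rpow.const_mul _)
          (Filter.Eventually.of_forall fun z => norm_truncIn_sq_le hτ hp2 z)
    _ ≤ _ := by
        rw [integral_const_mul]
        exact mul_le_mul_of_nonneg_left (hP.integral_norm_rpow_le hσ) (by positivity)

theorem NoiseDensity.integral_norm_truncOut_le (hP : NoiseDensity P p σ) (hσ : 0 < σ) (hp : 1 < p)
    {τ : ℝ} (hτ : 0 < τ) :
    ∫ z, ‖truncOut τ z‖ ∂noiseLaw P ≤ τ ^ (1 - p) * σ ^ p := by
  calc ∫ z, ‖truncOut τ z‖ ∂noiseLaw P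
      ≤ ∫ z, τ ^ (1 - p) * ‖z‖ ^ p ∂noiseLaw P :=
        integral_mono_of_nonneg (Filter.Eventually.of_forall fun z => by positivity)
          (hP.integrable_norm_rpow.const_mul _)
          (Filter.Eventually.of_forall fun z => norm_truncOut_le hτ hp z)
    _ ≤ _ := by
        rw [integral_const_mul]
        exact mul_le_mul_of_nonneg_left (hP.integral_norm_rpow_le hσ) (by positivity)

/-- The noise is centred, so the mean of the inner part is minus the mean of the tail. -/
theorem NoiseDensity.norm_integral_truncIn_le (hP : NoiseDensity P p σ) (hσ : 0 < σ) (hp : 1 < p)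
    {τ : ℝ} (hτ : 0 < τ) :
    ‖∫ z, truncIn τ z ∂noiseLaw P‖ ≤ τ ^ (1 - p) * σ ^ p := by
  have h1 : ∫ z, truncIn τ z ∂noiseLaw P + ∫ z, truncOut τ z ∂noiseLaw P = 0 := by
    rw [← integral_add (hP.integrable_truncIn hτ) (hP.integrable_truncOut hp hτ)]
    simp only [truncIn_add_truncOut]
    exact hP.centred
  rw [eq_neg_of_add_eq_zero_left h1, norm_neg]
  exact (norm_integral_le_integral_norm _).trans (hP.integral_norm_truncOut_le hσ hp hτ)

end truncation

section average

variable {Ω ι : Type*} [MeasurableSpace Ω] {μ : Measure Ω}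

/-- The second moment of a sum of pairwise independent bounded centred vectors. -/
theorem integral_norm_sum_sq_le [IsProbabilityMeasure μ] {Y : ι → Ω → Vec d} (s : Finset ι)
    {M V : ℝ}
    (hm : ∀ i ∈ s, AEMeasurable (Y i) μ) (hbd : ∀ i ∈ s, ∀ ω, ‖Y i ω‖ ≤ M)
    (hind : ∀ i ∈ s, ∀ j ∈ s, i ≠ j → IndepFun (Y i) (Y j) μ)
    (h0 : ∀ i ∈ s, ∫ ω, Y i ω ∂μ = 0) (hV : ∀ i ∈ s, ∫ ω, ‖Y i ω‖ ^ 2 ∂μ ≤ V) :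
    ∫ ω, ‖∑ i ∈ s, Y i ω‖ ^ 2 ∂μ ≤ s.card * V := by
  classical
  have hint : ∀ i ∈ s, ∀ j ∈ s, Integrable (fun ω => inner ℝ (Y i ω) (Y j ω)) μ := by
    intro i hi j hj
    refine Integrable.of_bound ((hm i hi).aestronglyMeasurable.inner
      (hm j hj).aestronglyMeasurable) (M * M) (Filter.Eventually.of_forall fun ω => ?_)
    refine (norm_inner_le_norm _ _).trans ?_
    exact mul_le_mul (hbd i hi ω) (hbd j hj ω) (norm_nonneg _)
      ((norm_nonneg _).trans (hbd i hi ω))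
  have h1 : ∀ ω, ‖∑ i ∈ s, Y i ω‖ ^ 2 = ∑ i ∈ s, ∑ j ∈ s, inner ℝ (Y i ω) (Y j ω) := by
    intro ω
    rw [← real_inner_self_eq_norm_sq, sum_inner]
    simp only [inner_sum]
  simp only [h1]
  rw [integral_finsetSum _ fun i hi => integrable_finsetSum _ fun j hj => hint i hi j hj]
  rw [← nsmul_eq_mul]
  refine Finset.sum_le_card_nsmul _ _ _ fun i hi => ?_
  rw [integral_finsetSum _ fun j hj => hint i hi j hj, Finset.sum_eq_single_of_mem i hi]
  · simpa only [real_inner_self_eq_norm_sq] using hV i hi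
  · intro j hj hji
    have h2 := (hind i hi j hj hji.symm).integral_bilin
      (Integrable.of_bound (hm i hi).aestronglyMeasurable M
        (Filter.Eventually.of_forall (hbd i hi)))
      (Integrable.of_bound (hm j hj).aestronglyMeasurable M
        (Filter.Eventually.of_forall (hbd j hj))) (innerSL ℝ)
    have h3 : ∫ ω, inner ℝ (Y i ω) (Y j ω) ∂μ = innerSL ℝ (∫ ω, Y i ω ∂μ) (∫ ω, Y j ω ∂μ) := h2
    rw [h3, h0 i hi, map_zero, zero_apply]

/-- Integrating ‖Y‖ ≤ c/2 + ‖Y‖²/(2c) replaces Cauchy-Schwarz. -/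
theorem integral_norm_le_of_integral_norm_sq_le [IsProbabilityMeasure μ] {Y : Ω → Vec d}
    (hY : Integrable Y μ) (hY2 : Integrable (fun ω => ‖Y ω‖ ^ 2) μ) {c : ℝ} (hc : 0 < c)
    (h : ∫ ω, ‖Y ω‖ ^ 2 ∂μ ≤ c ^ 2) : ∫ ω, ‖Y ω‖ ∂μ ≤ c := by
  calc ∫ ω, ‖Y ω‖ ∂μ ≤ ∫ ω, (c / 2 + (2 * c)⁻¹ * ‖Y ω‖ ^ 2) ∂μ := by
        refine integral_mono hY.norm ((integrable_const _).add (hY2.const_mul _)) fun ω => ?_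
        have h1 : c / 2 + (2 * c)⁻¹ * ‖Y ω‖ ^ 2 - ‖Y ω‖ = (2 * c)⁻¹ * (‖Y ω‖ - c) ^ 2 := by
          field_simp
          ring
        have h2 : 0 ≤ (2 * c)⁻¹ * (‖Y ω‖ - c) ^ 2 := by positivity
        linarith
    _ = c / 2 + (2 * c)⁻¹ * ∫ ω, ‖Y ω‖ ^ 2 ∂μ := by
        rw [integral_add (integrable_const _) (hY2.const_mul _), integral_const_mul]
        simp
    _ ≤ c / 2 + (2 * c)⁻¹ * c ^ 2 := by gcongr
    _ = c := by field_simp; ring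

/-- The mean of a batch of pairwise independent noise vectors is small in expectation. -/
theorem NoiseDensity.integral_norm_average_le [IsProbabilityMeasure μ] (hP : NoiseDensity P p σ)
    (hp : 1 < p) (hp2 : p ≤ 2) (hσ : 0 < σ) {X : ι → Ω → Vec d} {s : Finset ι}
    (hs : s.Nonempty) (hlaw : ∀ i ∈ s, μ.map (X i) = noiseLaw P)
    (hind : ∀ i ∈ s, ∀ j ∈ s, i ≠ j → IndepFun (X i) (X j) μ) :
    Integrable (fun ω => (s.card : ℝ)⁻¹ • ∑ i ∈ s, X i ω) μ ∧
      ∫ ω, ‖(s.card : ℝ)⁻¹ • ∑ i ∈ s, X i ω‖ ∂μ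
        ≤ 3 * σ * (s.card : ℝ) ^ (-((p - 1) / p)) := by
  have hPr := hP.isProbabilityMeasure
  have hX : ∀ i ∈ s, AEMeasurable (X i) μ := fun i hi =>
    AEMeasurable.of_map_ne_zero (by rw [hlaw i hi]; exact hPr.ne_zero)
  have hp0 : 0 < p := by linarith
  set n : ℝ := (s.card : ℝ) with hn
  have hn0 : 0 < n := Nat.cast_pos.2 hs.card_pos
  -- This level balances the tail mean τ^(1-p)σ^p against the standard deviation
  -- (τ^(2-p)σ^p/n)^(1/2) of the truncated average: both equal c.
  set τ : ℝ := σ * n ^ (1 / p) with hτ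
  have hτ0 : 0 < τ := by positivity
  set c : ℝ := σ * n ^ (-((p - 1) / p)) with hc
  have hc0 : 0 < c := by positivity
  have hτ1 : τ ^ (1 - p) * σ ^ p = c := by
    rw [hτ, Real.mul_rpow hσ.le (by positivity), ← Real.rpow_mul hn0.le, mul_right_comm,
      ← Real.rpow_add hσ, sub_add_cancel, Real.rpow_one, hc]
    congr 2
    field_simp
    ring
  have hτ2 : τ ^ (2 - p) * σ ^ p = n * c ^ 2 := by
    rw [hτ, Real.mul_rpow hσ.le (by positivity), ← Real.rpow_mul hn0.le, mul_right_comm,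
      ← Real.rpow_add hσ, sub_add_cancel, Real.rpow_two, hc, mul_pow, ← Real.rpow_natCast,
      ← Real.rpow_natCast, ← Real.rpow_mul hn0.le, mul_left_comm]
    congr 1
    have h1 : ∀ e : ℝ, n * n ^ e = n ^ (1 + e) := fun e => by rw [Real.rpow_add hn0, Real.rpow_one]
    rw [h1]
    congr 1
    push_cast
    field_simp
    ring
  set m : Vec d := ∫ z, truncIn τ z ∂noiseLaw P with hm
  have hmc : ‖m‖ ≤ c := hτ1 ▸ hP.norm_integral_truncIn_le hσ hp hτ0
  set Y : ι → Ω → Vec d := fun i ω => truncIn τ (X i ω) - m with hY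
  have hmY : Measurable fun z : Vec d => truncIn τ z - m :=
    (measurable_truncIn τ).sub_const m
  have hYm : ∀ i ∈ s, AEMeasurable (Y i) μ := fun i hi => hmY.comp_aemeasurable (hX i hi)
  have hYb : ∀ i ∈ s, ∀ ω, ‖Y i ω‖ ≤ τ + ‖m‖ := fun i _ ω =>
    (norm_sub_le _ _).trans (add_le_add (norm_truncIn_le hτ0.le _) le_rfl)
  have hTi : ∀ i ∈ s, Integrable (fun ω => truncIn τ (X i ω)) μ := fun i hi =>
    Integrable.of_bound ((measurable_truncIn τ).comp_aemeasurable (hX i hi)).aestronglyMeasurable τ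
      (Filter.Eventually.of_forall fun ω => norm_truncIn_le hτ0.le _)
  have hT : ∀ i ∈ s, ∫ ω, truncIn τ (X i ω) ∂μ = m := fun i hi => by
    rw [← integral_map (hX i hi) (measurable_truncIn τ).aestronglyMeasurable, hlaw i hi]
  have hY0 : ∀ i ∈ s, ∫ ω, Y i ω ∂μ = 0 := fun i hi => by
    rw [integral_sub (hTi i hi) (integrable_const _), hT i hi]
    simp
  have hYsq : ∀ i ∈ s, ∫ ω, ‖Y i ω‖ ^ 2 ∂μ ≤ n * c ^ 2 := fun i hi => by
    have hsq : Integrable (fun ω => ‖truncIn τ (X i ω)‖ ^ 2) μ :=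
      Integrable.of_bound
        (((measurable_truncIn τ).comp_aemeasurable (hX i hi)).norm.pow_const 2).aestronglyMeasurable
        (τ ^ 2) (Filter.Eventually.of_forall fun ω => by
          rw [Real.norm_of_nonneg (by positivity)]
          exact pow_le_pow_left₀ (norm_nonneg _) (norm_truncIn_le hτ0.le _) 2)
    have hin : Integrable (fun ω => inner ℝ (truncIn τ (X i ω)) m) μ := (hTi i hi).inner_const m
    have hin2 : ∫ ω, inner ℝ (truncIn τ (X i ω)) m ∂μ = ‖m‖ ^ 2 := by
      simp only [real_inner_comm m]
      rw [integral_inner (hTi i hi), hT i hi, real_inner_self_eq_norm_sq]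
    have h1 : ∀ ω, ‖Y i ω‖ ^ 2
        = ‖truncIn τ (X i ω)‖ ^ 2 - 2 * inner ℝ (truncIn τ (X i ω)) m + ‖m‖ ^ 2 := fun ω =>
      norm_sub_sq_real _ _
    simp only [h1]
    have hsub : Integrable (fun ω => ‖truncIn τ (X i ω)‖ ^ 2
        - 2 * inner ℝ (truncIn τ (X i ω)) m) μ := hsq.sub (hin.const_mul 2)
    rw [integral_add hsub (integrable_const _),
      integral_sub hsq (hin.const_mul 2), integral_const_mul, hin2]
    have h2 : ∫ ω, ‖truncIn τ (X i ω)‖ ^ 2 ∂μ ≤ n * c ^ 2 := by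
      rw [← integral_map (hX i hi) (f := fun z => ‖truncIn τ z‖ ^ 2)
        ((measurable_truncIn τ).norm.pow_const 2).aestronglyMeasurable, hlaw i hi, ← hτ2]
      exact hP.integral_truncIn_sq_le hσ hp2 hτ0
    simp only [integral_const, probReal_univ, one_smul]
    nlinarith [sq_nonneg ‖m‖]
  have hYind : ∀ i ∈ s, ∀ j ∈ s, i ≠ j → IndepFun (Y i) (Y j) μ := fun i hi j hj hij =>
    (hind i hi j hj hij).comp hmY hmY
  have hsum := integral_norm_sum_sq_le s hYm hYb hYind hY0 hYsq
  have hRi : ∀ i ∈ s, Integrable (fun ω => truncOut τ (X i ω)) μ := fun i hi =>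
    Integrable.comp_aemeasurable (f := X i) (g := truncOut τ)
      (by rw [hlaw i hi]; exact hP.integrable_truncOut hp hτ0) (hX i hi)
  have hR : ∀ i ∈ s, ∫ ω, ‖truncOut τ (X i ω)‖ ∂μ ≤ c := fun i hi => by
    rw [← integral_map (hX i hi) (f := fun z => ‖truncOut τ z‖)
      (measurable_truncOut τ).norm.aestronglyMeasurable, hlaw i hi, ← hτ1]
    exact hP.integral_norm_truncOut_le hσ hp hτ0
  have hYi : ∀ i ∈ s, Integrable (Y i) μ := fun i hi => (hTi i hi).sub (integrable_const _)
  set A : Ω → Vec d := fun ω => n⁻¹ • ∑ i ∈ s, Y i ω with hA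
  have hAi : Integrable A μ := (integrable_finsetSum _ hYi).smul n⁻¹
  have hAb : ∀ ω, ‖∑ i ∈ s, Y i ω‖ ≤ s.card • (τ + ‖m‖) := fun ω =>
    (norm_sum_le _ _).trans (Finset.sum_le_card_nsmul _ _ _ fun i hi => hYb i hi ω)
  have hAsqe : ∀ ω, ‖A ω‖ ^ 2 = (n ^ 2)⁻¹ * ‖∑ i ∈ s, Y i ω‖ ^ 2 := fun ω => by
    rw [hA, norm_smul, mul_pow, Real.norm_of_nonneg (by positivity), inv_pow]
  have hA2 : Integrable (fun ω => ‖A ω‖ ^ 2) μ := by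
    simp only [hAsqe]
    refine Integrable.const_mul (Integrable.of_bound
      ((integrable_finsetSum _ hYi).aestronglyMeasurable.norm.pow 2) ((s.card • (τ + ‖m‖)) ^ 2)
      (Filter.Eventually.of_forall fun ω => ?_)) _
    rw [Pi.pow_apply, norm_pow, norm_norm]
    exact pow_le_pow_left₀ (norm_nonneg _) (hAb ω) 2
  have hA1 : ∫ ω, ‖A ω‖ ∂μ ≤ c := by
    refine integral_norm_le_of_integral_norm_sq_le hAi hA2 hc0 ?_
    simp only [hAsqe]
    rw [integral_const_mul]
    calc (n ^ 2)⁻¹ * ∫ ω, ‖∑ i ∈ s, Y i ω‖ ^ 2 ∂μ ≤ (n ^ 2)⁻¹ * (n * (n * c ^ 2)) := by gcongr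
      _ = c ^ 2 := by field_simp
  set R : Ω → Vec d := fun ω => n⁻¹ • ∑ i ∈ s, truncOut τ (X i ω) with hRdef
  have hRint : Integrable R μ := (integrable_finsetSum _ hRi).smul n⁻¹
  have hR1 : ∫ ω, ‖R ω‖ ∂μ ≤ c := by
    calc ∫ ω, ‖R ω‖ ∂μ ≤ ∫ ω, n⁻¹ * ∑ i ∈ s, ‖truncOut τ (X i ω)‖ ∂μ := by
          refine integral_mono hRint.norm
            ((integrable_finsetSum _ fun i hi => (hRi i hi).norm).const_mul _) fun ω => ?_
          simp only [hRdef, norm_smul]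
          rw [Real.norm_of_nonneg (by positivity)]
          exact mul_le_mul_of_nonneg_left (norm_sum_le _ _) (by positivity)
      _ = n⁻¹ * ∑ i ∈ s, ∫ ω, ‖truncOut τ (X i ω)‖ ∂μ := by
          rw [integral_const_mul, integral_finsetSum _ fun i hi => (hRi i hi).norm]
      _ ≤ n⁻¹ * (s.card • c) := by
          gcongr
          exact Finset.sum_le_card_nsmul _ _ _ hR
      _ = c := by
          rw [nsmul_eq_mul, ← hn]
          field_simp
  -- Centred truncated average, tail average and truncation bias contribute at most c each, hence
  -- the factor 3.
  have hdec : ∀ ω, n⁻¹ • ∑ i ∈ s, X i ω = A ω + R ω + m := fun ω => by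
    have h1 : ∑ i ∈ s, X i ω = ∑ i ∈ s, Y i ω + ∑ i ∈ s, truncOut τ (X i ω) + n • m := by
      have h2 : n • m = ∑ i ∈ s, m := by
        rw [Finset.sum_const, hn, Nat.cast_smul_eq_nsmul]
      rw [h2, ← Finset.sum_add_distrib, ← Finset.sum_add_distrib]
      refine Finset.sum_congr rfl fun i _ => ?_
      refine (truncIn_add_truncOut τ (X i ω)).symm.trans ?_
      simp only [hY]
      abel
    rw [h1, smul_add, smul_add, smul_smul, inv_mul_cancel₀ hn0.ne', one_smul]
  simp only [hdec]
  refine ⟨(hAi.add hRint).add (integrable_const _), ?_⟩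
  calc ∫ ω, ‖A ω + R ω + m‖ ∂μ ≤ ∫ ω, (‖A ω‖ + ‖R ω‖ + ‖m‖) ∂μ :=
        integral_mono ((hAi.add hRint).add (integrable_const _)).norm
          ((hAi.norm.add hRint.norm).add (integrable_const _)) fun ω => norm_add₃_le
    _ = ∫ ω, ‖A ω‖ ∂μ + ∫ ω, ‖R ω‖ ∂μ + ‖m‖ := by
        have hAR : Integrable (fun ω => ‖A ω‖ + ‖R ω‖) μ := hAi.norm.add hRint.norm
        rw [integral_add hAR (integrable_const _),
          integral_add hAi.norm hRint.norm]
        simp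
    _ ≤ c + c + c := by gcongr
    _ = _ := by rw [hc]; ring

end average

end

/-! ### Exponential moment of one step, and smoothness of the cost -/

section

variable {d : ℕ} {P : Vec d → ℝ} {p σ : ℝ}
variable {Ω : Type*} [MeasurableSpace Ω] {μ : Measure Ω} {Ψ : Vec d → Vec d} {C K : ℝ}

/-- The average of the noise vectors `z 3, …, z (B + 2)`. -/
def batchNoise (B : ℕ) (z : ℕ → Vec d) : Vec d :=
  (B : ℝ)⁻¹ • ∑ j ∈ Finset.Icc 1 B, z (j + 2)

/-- One iteration of the method consumes the vector `Ψ (v + z 1 - z 2 + batchNoise B z)`, with `v`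
the gradient at the current model. -/
def noisyDirection (Ψ : Vec d → Vec d) (B : ℕ) (v : Vec d) (z : ℕ → Vec d) : Vec d :=
  Ψ (v + (z 1 - z 2) + batchNoise B z)

/-- Hoeffding's lemma: a variable with values in [-R, R] is sub-Gaussian about its mean with
variance proxy R². Since α ≥ 0, a lower bound for the mean suffices. -/
theorem integral_exp_neg_mul_le_of_abs_le [IsProbabilityMeasure μ] {Y : Ω → ℝ} {R m α : ℝ}
    (hY : AEMeasurable Y μ) (hR : ∀ ω, |Y ω| ≤ R) (hα : 0 ≤ α) (hm : m ≤ ∫ ω, Y ω ∂μ) :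
    Integrable (fun ω => Real.exp (-α * Y ω)) μ ∧
      ∫ ω, Real.exp (-α * Y ω) ∂μ ≤ Real.exp (-α * m + α ^ 2 * R ^ 2 / 2) := by
  have hb : ∀ᵐ ω ∂μ, Y ω ∈ Set.Icc (-R) R :=
    Filter.Eventually.of_forall fun ω => abs_le.1 (hR ω)
  have hH := hasSubgaussianMGF_of_mem_Icc hY hb
  have h1 := hH.mgf_le (-α)
  have hR0 : 0 ≤ R := by
    obtain ⟨ω⟩ := nonempty_of_isProbabilityMeasure μ
    exact (abs_nonneg _).trans (hR ω)
  have h2 : ∀ ω, Real.exp (-α * Y ω)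
      = Real.exp (-α * ∫ ω, Y ω ∂μ) * Real.exp (-α * (Y ω - ∫ ω, Y ω ∂μ)) := fun ω => by
    rw [← Real.exp_add]
    congr 1
    ring
  simp only [h2]
  refine ⟨(hH.integrable_exp_mul (-α)).const_mul _, ?_⟩
  rw [integral_const_mul]
  calc _ ≤ Real.exp (-α * ∫ ω, Y ω ∂μ) * Real.exp (((‖R - -R‖₊ / 2) ^ 2 : NNReal) * (-α) ^ 2 / 2) :=
        mul_le_mul_of_nonneg_left h1 (Real.exp_pos _).le
    _ ≤ _ := by
        rw [← Real.exp_add]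
        refine Real.exp_le_exp.2 ?_
        have h3 : (((‖R - -R‖₊ / 2) ^ 2 : NNReal) : ℝ) = R ^ 2 := by
          push_cast
          rw [sub_neg_eq_add, Real.norm_of_nonneg (by linarith)]
          ring
        rw [h3]
        nlinarith

/-- The conditional exponential moment of one step along the noisy direction. -/
theorem lintegral_exp_noisyDirection_le [IsProbabilityMeasure μ] (hΨ : SmoothNonlinearity Ψ C K)
    (hK : 0 ≤ K) (hP : NoiseDensity P p σ) (hp : 1 < p) (hp2 : p ≤ 2) (hσ : 0 < σ)
    {B : ℕ} (hB : 0 < B) {Z : ℕ → Ω → Vec d}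
    (hlaw : ∀ j ∈ Finset.Icc 1 (B + 2), μ.map (Z j) = noiseLaw P)
    (hind : ∀ i ∈ Finset.Icc 1 (B + 2), ∀ j ∈ Finset.Icc 1 (B + 2), i ≠ j →
      IndepFun (Z i) (Z j) μ) (v : Vec d) {α : ℝ} (hα : 0 ≤ α) :
    ∫⁻ ω, ENNReal.ofReal (Real.exp (-α * inner ℝ v (noisyDirection Ψ B v fun j => Z j ω))) ∂μ
      ≤ ENNReal.ofReal (Real.exp (-α * (inner ℝ (denoised Ψ P v) v
          - ‖v‖ * (K * (3 * σ * (B : ℝ) ^ (-((p - 1) / p))))) + α ^ 2 * (C * ‖v‖) ^ 2 / 2)) := by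
  have hPr := hP.isProbabilityMeasure
  have hΨc := hΨ.continuous hK
  have hZ : ∀ j ∈ Finset.Icc 1 (B + 2), AEMeasurable (Z j) μ := fun j hj =>
    AEMeasurable.of_map_ne_zero (by rw [hlaw j hj]; exact hPr.ne_zero)
  have h1 : 1 ∈ Finset.Icc 1 (B + 2) := Finset.mem_Icc.2 ⟨by omega, by omega⟩
  have h2 : 2 ∈ Finset.Icc 1 (B + 2) := Finset.mem_Icc.2 ⟨by omega, by omega⟩
  have h3 : ∀ j ∈ Finset.Icc 1 B, j + 2 ∈ Finset.Icc 1 (B + 2) := fun j hj => by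
    simp only [Finset.mem_Icc] at hj ⊢
    omega
  obtain ⟨hei, hen⟩ := hP.integral_norm_average_le hp hp2 hσ (X := fun j => Z (j + 2))
    (s := Finset.Icc 1 B) (Finset.nonempty_Icc.2 hB) (fun j hj => hlaw _ (h3 j hj))
    (fun i hi j hj hij => hind _ (h3 i hi) _ (h3 j hj) (by simpa using hij))
  rw [Nat.card_Icc, Nat.add_sub_cancel] at hei hen
  set e : Ω → Vec d := fun ω => batchNoise B fun j => Z j ω with he
  replace hei : Integrable e μ := hei
  set Y : Ω → ℝ := fun ω => inner ℝ v (noisyDirection Ψ B v fun j => Z j ω) with hY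
  set Y₀ : Ω → ℝ := fun ω => inner ℝ v (Ψ (v + (Z 1 ω - Z 2 ω))) with hY₀
  have hw : AEMeasurable (fun ω => v + (Z 1 ω - Z 2 ω)) μ :=
    ((hZ 1 h1).sub (hZ 2 h2)).const_add v
  have hYm : AEMeasurable Y μ :=
    ((continuous_const.inner hΨc).measurable).comp_aemeasurable (hw.add hei.aemeasurable)
  have hY₀m : AEMeasurable Y₀ μ :=
    ((continuous_const.inner hΨc).measurable).comp_aemeasurable hw
  have hYb : ∀ ω, |Y ω| ≤ C * ‖v‖ := fun ω => by
    rw [mul_comm]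
    exact (abs_real_inner_le_norm _ _).trans
      (mul_le_mul_of_nonneg_left (hΨ.bounded _) (norm_nonneg _))
  have hY₀b : ∀ ω, |Y₀ ω| ≤ C * ‖v‖ := fun ω => by
    rw [mul_comm]
    exact (abs_real_inner_le_norm _ _).trans
      (mul_le_mul_of_nonneg_left (hΨ.bounded _) (norm_nonneg _))
  have hYi : Integrable Y μ := Integrable.of_bound hYm.aestronglyMeasurable _
    (Filter.Eventually.of_forall hYb)
  have hY₀i : Integrable Y₀ μ := Integrable.of_bound hY₀m.aestronglyMeasurable _
    (Filter.Eventually.of_forall hY₀b)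
  have hY₀int : ∫ ω, Y₀ ω ∂μ = inner ℝ (denoised Ψ P v) v := by
    have hj : μ.map (fun ω => (Z 1 ω, Z 2 ω)) = (noiseLaw P).prod (noiseLaw P) := by
      rw [(indepFun_iff_map_prod_eq_prod_map_map (hZ 1 h1) (hZ 2 h2)).1
        (hind 1 h1 2 h2 (by norm_num)), hlaw 1 h1, hlaw 2 h2]
    have hc : Continuous fun w : Vec d × Vec d => inner ℝ v (Ψ (v + (w.1 - w.2))) :=
      continuous_const.inner (hΨc.comp (by fun_prop))
    have h4 := integral_map ((hZ 1 h1).prodMk (hZ 2 h2)) (f := fun w : Vec d × Vec d =>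
      (inner ℝ v (Ψ (v + (w.1 - w.2))) : ℝ)) hc.aestronglyMeasurable
    rw [hj, integral_inner (integrable_denoised hΨc hΨ.bounded hP v)] at h4
    rw [real_inner_comm]
    exact h4.symm
  -- The batch average is removed pointwise through the Lipschitz bound. Only its mean norm enters
  -- afterwards.
  have hYY : ∀ ω, Y₀ ω - ‖v‖ * (K * ‖e ω‖) ≤ Y ω := fun ω => by
    have h5 : Y₀ ω - Y ω = inner ℝ v
        (Ψ (v + (Z 1 ω - Z 2 ω)) - Ψ (v + (Z 1 ω - Z 2 ω) + e ω)) := (inner_sub_right _ _ _).symm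
    have h6 := (real_inner_le_norm v
        (Ψ (v + (Z 1 ω - Z 2 ω)) - Ψ (v + (Z 1 ω - Z 2 ω) + e ω))).trans
      (mul_le_mul_of_nonneg_left (hΨ.lipschitz hK _ _) (norm_nonneg v))
    rw [← h5, sub_add_cancel_left, norm_neg] at h6
    linarith
  have hm : inner ℝ (denoised Ψ P v) v - ‖v‖ * (K * (3 * σ * (B : ℝ) ^ (-((p - 1) / p))))
      ≤ ∫ ω, Y ω ∂μ := by
    calc _ ≤ ∫ ω, Y₀ ω ∂μ - ‖v‖ * (K * ∫ ω, ‖e ω‖ ∂μ) := by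
          rw [hY₀int]
          gcongr
          exact hen
      _ = ∫ ω, (Y₀ ω - ‖v‖ * (K * ‖e ω‖)) ∂μ := by
          rw [integral_sub hY₀i ((hei.norm.const_mul K).const_mul ‖v‖), integral_const_mul,
            integral_const_mul]
      _ ≤ _ := integral_mono (hY₀i.sub ((hei.norm.const_mul K).const_mul ‖v‖)) hYi hYY
  obtain ⟨hint, hle⟩ := integral_exp_neg_mul_le_of_abs_le hYm hYb hα hm
  rw [← ofReal_integral_eq_lintegral_ofReal hint
    (Filter.Eventually.of_forall fun ω => (Real.exp_pos _).le)]
  exact ENNReal.ofReal_le_ofReal hle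

/-- A differentiable function with `L`-Lipschitz gradient lies below a quadratic. -/
theorem SmoothCost.le_add_inner_add {F : Vec d → ℝ} {L : ℝ} (hF : SmoothCost F L) (hL : 0 ≤ L)
    (x h : Vec d) : F (x + h) ≤ F x + inner ℝ (gradient F x) h + L * ‖h‖ ^ 2 := by
  have hder : ∀ z, HasFDerivAt F (innerSL ℝ (gradient F z)) z := fun z =>
    (hF.differentiable z).hasGradientAt.hasFDerivAt
  have hx : x ∈ Metric.closedBall x ‖h‖ := Metric.mem_closedBall_self (norm_nonneg _)
  have hxh : x + h ∈ Metric.closedBall x ‖h‖ := by simp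
  -- On this ball the gradient differs from its value at the centre by at most L‖h‖. The mean value
  -- inequality then gives the constant L, instead of the sharp L/2, which is enough here.
  have h1 := (convex_closedBall x ‖h‖).norm_image_sub_le_of_norm_hasFDerivWithin_le'
    (fun z _ => (hder z).hasFDerivWithinAt) (φ := innerSL ℝ (gradient F x)) (C := L * ‖h‖)
    (fun z hz => ?_) hx hxh
  · rw [add_sub_cancel_left] at h1
    have h2 := (le_abs_self _).trans h1
    have h3 : innerSL ℝ (gradient F x) h = inner ℝ (gradient F x) h := rfl
    rw [h3] at h2
    nlinarith
  · rw [← map_sub, innerSL_apply_norm]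
    refine (hF.lipschitz z x).trans (mul_le_mul_of_nonneg_left ?_ hL)
    rw [← dist_eq_norm]
    exact hz

theorem SmoothCost.continuous_gradient {F : Vec d → ℝ} {L : ℝ} (hF : SmoothCost F L)
    (hL : 0 ≤ L) : Continuous (gradient F) :=
  (LipschitzWith.of_dist_le_mul (K := ⟨L, hL⟩) fun x y => by
    rw [dist_eq_norm, dist_eq_norm]
    exact hF.lipschitz x y).continuous

end

/-! ### The recursion driven by the noise; gradient growth, measurability, independence -/

section

variable {d : ℕ} {P : Vec d → ℝ} {p σ : ℝ}
variable {Ω : Type*} {Ψ : Vec d → Vec d} {C K : ℝ}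

/-- Extension by zero of a family of vectors indexed by a finite set of natural numbers. -/
def extendZero (s : Finset ℕ) (z : s → Vec d) (j : ℕ) : Vec d :=
  if h : j ∈ s then z ⟨j, h⟩ else 0

theorem measurable_extendZero (s : Finset ℕ) : Measurable (extendZero (d := d) s) := by
  refine measurable_pi_lambda _ fun j => ?_
  by_cases h : j ∈ s
  · simpa only [extendZero, h, dite_true] using measurable_pi_apply _
  · simpa only [extendZero, h, dite_false] using measurable_const

theorem extendZero_restrict {s : Finset ℕ} (z : ℕ → Vec d) {j : ℕ} (hj : j ∈ s) :
    extendZero s (fun k : s => z k) j = z j := by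
  simp [extendZero, hj]

section recursion

variable {Ξ : Type*} {f : Vec d → Ξ → ℝ} {F : Vec d → ℝ} {y : Vec d}

theorem one_le_batchSize {t : ℕ} (ht : 1 ≤ t) : 1 ≤ batchSize p t :=
  Nat.one_le_ceil_iff.2 (Real.rpow_pos_of_pos (by exact_mod_cast ht) _)

/-- The batch mean restores the ∇F(y) that the second oracle call subtracts, leaving ∇F(x) plus
noise. -/
theorem msge_eq {B : ℕ} (hB : 1 ≤ B) (x : Vec d) (s : ℕ → Ξ) :
    msge f y B x s = gradient F x + (gradNoise f F y x s 1 - gradNoise f F y x s 2)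
      + batchNoise B (gradNoise f F y x s) := by
  have h1 : gradNoise f F y x s 1 = oracle f x (s 1) - gradient F x := if_pos rfl
  have h2 : gradNoise f F y x s 2 = oracle f y (s 2) - gradient F y := if_neg (by norm_num)
  have h3 : ∑ j ∈ Finset.Icc 1 B, gradNoise f F y x s (j + 2)
      = ∑ j ∈ Finset.Icc 1 B, oracle f y (s (j + 2)) - (B : ℝ) • gradient F y := by
    have h4 : (B : ℝ) • gradient F y = ∑ j ∈ Finset.Icc 1 B, gradient F y := by
      rw [Finset.sum_const, Nat.card_Icc, Nat.add_sub_cancel, Nat.cast_smul_eq_nsmul]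
    rw [h4, ← Finset.sum_sub_distrib]
    refine Finset.sum_congr rfl fun j _ => if_neg (by omega)
  have hB0 : (B : ℝ) ≠ 0 := by positivity
  rw [msge, batchNoise, h1, h2, h3, smul_sub, smul_smul, inv_mul_cancel₀ hB0, one_smul]
  abel

/-- Allows the finite noise family to be replaced by its extension by zero, so that all iterations
share one sequence space. -/
theorem noisyDirection_congr {B : ℕ} {v : Vec d} {z z' : ℕ → Vec d}
    (h : ∀ j ∈ Finset.Icc 1 (B + 2), z j = z' j) :
    noisyDirection Ψ B v z = noisyDirection Ψ B v z' := by
  have h3 : batchNoise B z = batchNoise B z' := by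
    unfold batchNoise
    congr 1
    refine Finset.sum_congr rfl fun j hj => h _ ?_
    simp only [Finset.mem_Icc] at hj ⊢
    omega
  rw [noisyDirection, noisyDirection, h3, h 1 (Finset.mem_Icc.2 ⟨by omega, by omega⟩),
    h 2 (Finset.mem_Icc.2 ⟨by omega, by omega⟩)]

theorem measurable_noisyDirection (hΨ : Continuous Ψ) (B : ℕ) :
    Measurable fun w : Vec d × (ℕ → Vec d) => noisyDirection Ψ B w.1 w.2 := by
  unfold noisyDirection batchNoise
  refine hΨ.measurable.comp ?_
  fun_prop

theorem norm_noisyDirection_le (hb : ∀ x, ‖Ψ x‖ ≤ C) (B : ℕ) (v : Vec d) (z : ℕ → Vec d) :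
    ‖noisyDirection Ψ B v z‖ ≤ C := hb _

variable {x₁ : Vec d} {ξ : ℕ → ℕ → Ω → Ξ} {x : ℕ → Ω → Vec d} {a η : ℝ}

theorem IsRun.step_eq (hrun : IsRun f Ψ p a η x₁ y ξ x) {t : ℕ} (ht : 1 ≤ t) (ω : Ω) :
    x (t + 1) ω = x t ω - stepSize a η t • noisyDirection Ψ (batchSize p t)
      (gradient F (x t ω)) (gradNoise f F y (x t ω) fun i => ξ t i ω) := by
  rw [hrun.step t ht ω, msge_eq (F := F) (one_le_batchSize ht)]
  rfl

/-- The noise of iteration `t`, as a sequence. -/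
def noiseSeq (f : Vec d → Ξ → ℝ) (F : Vec d → ℝ) (p : ℝ) (y : Vec d) (ξ : ℕ → ℕ → Ω → Ξ)
    (x : ℕ → Ω → Vec d) (t : ℕ) (ω : Ω) : ℕ → Vec d :=
  extendZero (Finset.Icc 1 (batchSize p t + 2))
    fun j => gradNoise f F y (x t ω) (fun i => ξ t i ω) j

/-- The models found up to iteration `t`, as a sequence. -/
def pastSeq (x : ℕ → Ω → Vec d) (t : ℕ) (ω : Ω) : ℕ → Vec d :=
  extendZero (Finset.Icc 1 t) fun k => x k ω

theorem IsRun.step_eq_noiseSeq (hrun : IsRun f Ψ p a η x₁ y ξ x) {t : ℕ} (ht : 1 ≤ t) (ω : Ω) :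
    x (t + 1) ω = x t ω - stepSize a η t • noisyDirection Ψ (batchSize p t)
      (gradient F (x t ω)) (noiseSeq f F p y ξ x t ω) := by
  rw [hrun.step_eq (F := F) ht]
  congr 2
  refine noisyDirection_congr fun j hj => ?_
  exact (extendZero_restrict _ hj).symm

theorem stepSize_half (a : ℝ) (t : ℕ) : stepSize a (1 / 2) t = a / √((t : ℝ) + 1) := by
  rw [stepSize, Real.sqrt_eq_rpow]

/-- The gradient norm grows at most like `√t` along a run. -/
theorem IsRun.norm_gradient_le (hrun : IsRun f Ψ p a (1 / 2) x₁ y ξ x) (hb : ∀ x, ‖Ψ x‖ ≤ C)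
    (hC : 0 ≤ C) {L : ℝ} (hF : SmoothCost F L) (hL : 0 ≤ L) (ha : 0 ≤ a) {t : ℕ} (ht : 1 ≤ t)
    (ω : Ω) : ‖gradient F (x t ω)‖ ≤ ‖gradient F x₁‖ + 2 * L * C * a * √t := by
  induction t, ht using Nat.le_induction with
  | base =>
    rw [hrun.init]
    have : 0 ≤ 2 * L * C * a * √((1 : ℕ) : ℝ) := by positivity
    linarith
  | succ t ht ih =>
    have hs : 0 < √((t : ℝ) + 1) := by positivity
    have h1 : ‖x (t + 1) ω - x t ω‖ ≤ a / √((t : ℝ) + 1) * C := by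
      rw [hrun.step_eq_noiseSeq (F := F) ht, sub_sub_cancel_left, norm_neg, norm_smul,
        stepSize_half, Real.norm_of_nonneg (by positivity)]
      exact mul_le_mul_of_nonneg_left (norm_noisyDirection_le hb _ _ _) (by positivity)
    have h2 := hF.lipschitz (x (t + 1) ω) (x t ω)
    have h3 : ‖gradient F (x (t + 1) ω)‖
        ≤ ‖gradient F (x t ω)‖ + ‖gradient F (x (t + 1) ω) - gradient F (x t ω)‖ :=
      norm_le_norm_add_norm_sub' _ _
    -- Makes the sum of the step sizes telescope to a multiple of √t.
    have h4 : 1 / √((t : ℝ) + 1) ≤ 2 * (√((t : ℝ) + 1) - √t) := by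
      rw [div_le_iff₀ hs]
      have e1 := Real.sq_sqrt (show 0 ≤ (t : ℝ) + 1 by positivity)
      have e2 := Real.sq_sqrt (show 0 ≤ (t : ℝ) by positivity)
      nlinarith [sq_nonneg (√((t : ℝ) + 1) - √t)]
    push_cast
    have h5 : L * (a / √((t : ℝ) + 1) * C) ≤ L * C * a * (2 * (√((t : ℝ) + 1) - √t)) := by
      calc L * (a / √((t : ℝ) + 1) * C) = L * C * a * (1 / √((t : ℝ) + 1)) := by ring
        _ ≤ _ := mul_le_mul_of_nonneg_left h4 (by positivity)
    have h6 := mul_le_mul_of_nonneg_left h1 hL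
    linarith

/-- The step sizes are small enough for the descent term to absorb the quadratic one. -/
theorem IsRun.stepSize_mul_sq_le (hrun : IsRun f Ψ p a (1 / 2) x₁ y ξ x) (hb : ∀ x, ‖Ψ x‖ ≤ C)
    (hC : 0 < C) {L γ₁ γ₂ : ℝ} (hF : SmoothCost F L) (hL : 0 < L) (ha : 0 < a)
    (hmax : a ≤ maxStep (1 / 2) γ₁ γ₂ C L ‖gradient F x₁‖) {t : ℕ} (ht : 1 ≤ t) (ω : Ω) :
    stepSize a (1 / 2) t * ((1 + 8 * C ^ 2) * ‖gradient F (x t ω)‖ ^ 2)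
      ≤ min (γ₁ * ‖gradient F (x t ω)‖) (γ₂ * ‖gradient F (x t ω)‖ ^ 2) := by
  set g := ‖gradient F (x t ω)‖ with hg
  set G := ‖gradient F x₁‖ with hG
  have hg0 : 0 ≤ g := norm_nonneg _
  have hG0 : 0 ≤ G := norm_nonneg _
  obtain ⟨ha1, ha23⟩ := le_min_iff.1 hmax
  obtain ⟨ha2, ha3⟩ := le_min_iff.1 ha23
  rw [le_div_iff₀ (by positivity)] at ha2
  rw [le_div_iff₀ (by norm_num; positivity)] at ha3
  have hs : 1 ≤ √((t : ℝ) + 1) := Real.one_le_sqrt.2 (by linarith [(Nat.cast_nonneg t : (0:ℝ) ≤ t)])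
  have hs0 : 0 < √((t : ℝ) + 1) := by linarith
  rw [stepSize_half]
  refine le_min ?_ ?_
  · have h1 := hrun.norm_gradient_le hb hC.le hF hL.le ha.le ht ω
    have h2 : √(t : ℝ) ≤ √((t : ℝ) + 1) := Real.sqrt_le_sqrt (by linarith)
    -- The √t growth of the gradient cancels against the step size, and a ≤ 1 removes the extra
    -- factor a. At η = 1/2 the third bound on a reads a(1 + 8C²)(2LC + G) ≤ γ₁.
    have h3 : a / √((t : ℝ) + 1) * g ≤ a * (G + 2 * L * C) := by
      rw [div_mul_eq_mul_div, div_le_iff₀ hs0, mul_assoc]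
      refine mul_le_mul_of_nonneg_left ?_ ha.le
      calc g ≤ G + 2 * L * C * a * √t := h1
        _ ≤ G * √((t : ℝ) + 1) + 2 * L * C * 1 * √((t : ℝ) + 1) := by
            gcongr
            exact le_mul_of_one_le_right hG0 hs
        _ = _ := by ring
    have h4 : a / √((t : ℝ) + 1) * g * (1 + 8 * C ^ 2) ≤ γ₁ := by
      refine (mul_le_mul_of_nonneg_right h3 (by positivity)).trans ?_
      linarith
    calc _ = a / √((t : ℝ) + 1) * g * (1 + 8 * C ^ 2) * g := by ring
      _ ≤ _ := mul_le_mul_of_nonneg_right h4 hg0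
  · have h3 : a / √((t : ℝ) + 1) ≤ a := div_le_self ha.le hs
    calc _ ≤ a * ((1 + 8 * C ^ 2) * g ^ 2) := mul_le_mul_of_nonneg_right h3 (by positivity)
      _ = a * (1 + 8 * C ^ 2) * g ^ 2 := by ring
      _ ≤ _ := mul_le_mul_of_nonneg_right ha2 (by positivity)

variable [MeasurableSpace Ω] {μ : Measure Ω}

/-- The supermartingale step without conditional expectations: independence makes the joint law a
product, and Tonelli freezes the past u while the fresh noise is integrated out. -/
theorem lintegral_mul_le_of_indepFun [IsProbabilityMeasure μ] {α β : Type*} [MeasurableSpace α]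
    [MeasurableSpace β] {H : Ω → α} {Z : Ω → β} (hHZ : IndepFun H Z μ) (hH : AEMeasurable H μ)
    (hZ : AEMeasurable Z μ) {h : α → ENNReal} (hh : Measurable h) {k : α × β → ENNReal}
    (hk : Measurable k) (hle : ∀ᵐ u ∂μ.map H, ∫⁻ ω, k (u, Z ω) ∂μ ≤ 1) :
    ∫⁻ ω, h (H ω) * k (H ω, Z ω) ∂μ ≤ ∫⁻ ω, h (H ω) ∂μ := by
  have hj := (indepFun_iff_map_prod_eq_prod_map_map hH hZ).1 hHZ
  have hg : Measurable fun w : α × β => h w.1 * k w := (hh.comp measurable_fst).mul hk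
  rw [← lintegral_map' (f := fun w : α × β => h w.1 * k w) (g := fun ω => (H ω, Z ω))
    hg.aemeasurable (hH.prodMk hZ), hj,
    lintegral_prod _ hg.aemeasurable, ← lintegral_map' hh.aemeasurable hH]
  refine lintegral_mono_ae ?_
  filter_upwards [hle] with u hu
  have hku : Measurable fun z => k (u, z) := hk.comp measurable_prodMk_left
  rw [lintegral_const_mul _ hku, lintegral_map' hku.aemeasurable hZ]
  exact mul_le_of_le_one_right' hu

theorem aemeasurable_noisyDirection (hΨ : Continuous Ψ) (B : ℕ) {v : Ω → Vec d}
    {z : Ω → ℕ → Vec d} (hv : AEMeasurable v μ) (hz : AEMeasurable z μ) :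
    AEMeasurable (fun ω => noisyDirection Ψ B (v ω) (z ω)) μ :=
  (measurable_noisyDirection hΨ B).comp_aemeasurable (hv.prodMk hz)

/-- The push-forward along a map that is not a.e. measurable is 0 by convention, whereas the noise
law is a probability measure. -/
theorem IIDNoise.aemeasurable (hN : IIDNoise μ f F P p y ξ x) (hP : NoiseDensity P p σ) {t : ℕ}
    (ht : 1 ≤ t) {j : ℕ} (hj : j ∈ Finset.Icc 1 (batchSize p t + 2)) :
    AEMeasurable (fun ω => gradNoise f F y (x t ω) (fun i => ξ t i ω) j) μ := by
  have := hP.isProbabilityMeasure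
  exact AEMeasurable.of_map_ne_zero (by rw [hN.law t ht j hj]; exact this.ne_zero)

theorem IIDNoise.aemeasurable_noiseSeq (hN : IIDNoise μ f F P p y ξ x) (hP : NoiseDensity P p σ)
    {t : ℕ} (ht : 1 ≤ t) : AEMeasurable (noiseSeq f F p y ξ x t) μ :=
  (measurable_extendZero _).comp_aemeasurable
    (aemeasurable_pi_lambda _ fun j => hN.aemeasurable hP ht j.2)

theorem IsRun.aemeasurable (hrun : IsRun f Ψ p a η x₁ y ξ x) (hN : IIDNoise μ f F P p y ξ x)
    (hP : NoiseDensity P p σ) (hΨ : Continuous Ψ) (hF : Continuous (gradient F)) {t : ℕ}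
    (ht : 1 ≤ t) : AEMeasurable (x t) μ := by
  induction t, ht using Nat.le_induction with
  | base =>
    have : x 1 = fun _ => x₁ := funext hrun.init
    rw [this]
    exact aemeasurable_const
  | succ t ht ih =>
    have : x (t + 1) = fun ω => x t ω - stepSize a η t • noisyDirection Ψ (batchSize p t)
        (gradient F (x t ω)) (noiseSeq f F p y ξ x t ω) := funext (hrun.step_eq_noiseSeq ht)
    rw [this]
    have hD := aemeasurable_noisyDirection hΨ (batchSize p t)
      (hF.measurable.comp_aemeasurable ih) (hN.aemeasurable_noiseSeq hP ht)
    exact ih.sub (hD.fun_const_smul _)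

theorem IsRun.aemeasurable_pastSeq (hrun : IsRun f Ψ p a η x₁ y ξ x)
    (hN : IIDNoise μ f F P p y ξ x) (hP : NoiseDensity P p σ) (hΨ : Continuous Ψ)
    (hF : Continuous (gradient F)) (t : ℕ) : AEMeasurable (pastSeq x t) μ :=
  (measurable_extendZero _).comp_aemeasurable
    (aemeasurable_pi_lambda _ fun k =>
      hrun.aemeasurable hN hP hΨ hF (Finset.mem_Icc.1 k.2).1)

theorem IIDNoise.indepFun_pastSeq (hN : IIDNoise μ f F P p y ξ x) {t : ℕ} (ht : 1 ≤ t) :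
    IndepFun (pastSeq x t) (noiseSeq f F p y ξ x t) μ :=
  (hN.indep_past t ht).comp (measurable_extendZero _) (measurable_extendZero _)

end recursion

end

/-! ### The exponential supermartingale -/

section

variable {d : ℕ} {P : Vec d → ℝ} {p σ : ℝ}
variable {Ω : Type*} [MeasurableSpace Ω] {μ : Measure Ω} {Ψ : Vec d → Vec d} {C K : ℝ}

/-- The lower bound on the descent guaranteed by an `IsDescentPair` at gradient `v`. -/
def descent (γ₁ γ₂ : ℝ) (v : Vec d) : ℝ := min (γ₁ * ‖v‖) (γ₂ * ‖v‖ ^ 2)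

theorem continuous_descent (γ₁ γ₂ : ℝ) : Continuous (descent (d := d) γ₁ γ₂) := by
  unfold descent
  fun_prop

/-- The cost along a sequence `u` of models, compensated by the guaranteed descent and by `c`. -/
def potential (F : Vec d → ℝ) (γ₁ γ₂ : ℝ) (α c : ℕ → ℝ) (u : ℕ → Vec d) (t : ℕ) : ℝ :=
  F (u (t + 1)) - F (u 1)
    + ∑ k ∈ Finset.Icc 1 t, (α k * descent γ₁ γ₂ (gradient F (u k)) / 2 - c k)

theorem measurable_potential {F : Vec d → ℝ} (hF : Continuous F) (hF' : Continuous (gradient F))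
    (γ₁ γ₂ : ℝ) (α c : ℕ → ℝ) (t : ℕ) :
    Measurable fun u => potential F γ₁ γ₂ α c u t := by
  have h1 := (continuous_descent (d := d) γ₁ γ₂).comp hF'
  have h2 : ∀ k, Measurable fun u : ℕ → Vec d => descent γ₁ γ₂ (gradient F (u k)) := fun k =>
    h1.measurable.comp (measurable_pi_apply k)
  have h3 : ∀ k, Measurable fun u : ℕ → Vec d => F (u k) := fun k =>
    hF.measurable.comp (measurable_pi_apply k)
  exact ((h3 _).sub (h3 _)).add (Finset.measurable_fun_sum _ fun k _ =>
    (((h2 k).const_mul (α k)).div_const 2).sub_const (c k))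

theorem potential_succ_sub (F : Vec d → ℝ) (γ₁ γ₂ : ℝ) (α c : ℕ → ℝ) (u : ℕ → Vec d) (t : ℕ) :
    potential F γ₁ γ₂ α c u (t + 1) = potential F γ₁ γ₂ α c u t
      + (F (u (t + 2)) - F (u (t + 1))
        + (α (t + 1) * descent γ₁ γ₂ (gradient F (u (t + 1))) / 2 - c (t + 1))) := by
  rw [potential, potential, Finset.sum_Icc_succ_top (by omega)]
  ring

theorem potential_congr (F : Vec d → ℝ) (γ₁ γ₂ : ℝ) (α c : ℕ → ℝ) {u u' : ℕ → Vec d} {t : ℕ}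
    (h : ∀ k ∈ Finset.Icc 1 (t + 1), u k = u' k) :
    potential F γ₁ γ₂ α c u t = potential F γ₁ γ₂ α c u' t := by
  rw [potential, potential, h 1 (Finset.mem_Icc.2 ⟨by omega, by omega⟩),
    h (t + 1) (Finset.mem_Icc.2 ⟨by omega, le_rfl⟩)]
  congr 1
  refine Finset.sum_congr rfl fun k hk => ?_
  rw [h k]
  simp only [Finset.mem_Icc] at hk ⊢
  omega

/-- The bias of the estimator caused by the batch average. -/
def batchBias (p σ K : ℝ) (t : ℕ) : ℝ :=
  K * (3 * σ * (batchSize p t : ℝ) ^ (-((p - 1) / p)))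

/-- The per-iteration error not absorbed by the descent. -/
def stepError (p σ C K L a : ℝ) (t : ℕ) : ℝ :=
  batchBias p σ K t ^ 2 / 2 + L * (stepSize a (1 / 2) t * C) ^ 2

theorem SmoothCost.sub_smul_le {F : Vec d → ℝ} {L : ℝ} (hF : SmoothCost F L) (hL : 0 ≤ L)
    (x : Vec d) {D : Vec d} {α : ℝ} (hα : 0 ≤ α) (hD : ‖D‖ ≤ C) :
    F (x - α • D) ≤ F x - α * inner ℝ (gradient F x) D + L * (α * C) ^ 2 := by
  have h2 := hF.le_add_inner_add hL x (-(α • D))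
  rw [← sub_eq_add_neg, inner_neg_right, inner_smul_right, norm_neg, norm_smul,
    Real.norm_of_nonneg hα] at h2
  have h3 : L * (α * ‖D‖) ^ 2 ≤ L * (α * C) ^ 2 := by gcongr
  linarith

/-- One step along the noisy direction, compensated by half of the descent and by the squared bias,
has exponential moment at most `1`. -/
theorem lintegral_exp_step_le_one [IsProbabilityMeasure μ] (hΨ : SmoothNonlinearity Ψ C K)
    (hK : 0 ≤ K) (hP : NoiseDensity P p σ) (hp : 1 < p) (hp2 : p ≤ 2) (hσ : 0 < σ)
    {γ₁ γ₂ : ℝ} (hD : IsDescentPair Ψ P γ₁ γ₂) {t : ℕ} (ht : 1 ≤ t) {Z : ℕ → Ω → Vec d}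
    (hlaw : ∀ j ∈ Finset.Icc 1 (batchSize p t + 2), μ.map (Z j) = noiseLaw P)
    (hind : ∀ i ∈ Finset.Icc 1 (batchSize p t + 2), ∀ j ∈ Finset.Icc 1 (batchSize p t + 2),
      i ≠ j → IndepFun (Z i) (Z j) μ) (v : Vec d) {α : ℝ} (hα : 0 ≤ α)
    (hv : α * ((1 + 8 * C ^ 2) * ‖v‖ ^ 2) ≤ descent γ₁ γ₂ v) :
    ∫⁻ ω, ENNReal.ofReal (Real.exp (-α * inner ℝ v
        (noisyDirection Ψ (batchSize p t) v fun j => Z j ω)))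
      * ENNReal.ofReal (Real.exp (α * descent γ₁ γ₂ v / 2 - batchBias p σ K t ^ 2 / 2)) ∂μ ≤ 1 := by
  have h1 := lintegral_exp_noisyDirection_le hΨ hK hP hp hp2 hσ
    (one_le_batchSize (p := p) ht) hlaw hind v hα
  rw [lintegral_mul_const' _ _ ENNReal.ofReal_ne_top]
  refine (mul_le_mul_left h1 _).trans ?_
  rw [← ENNReal.ofReal_mul (Real.exp_pos _).le, ← Real.exp_add, ENNReal.ofReal_le_one,
    Real.exp_le_one_iff, ← batchBias]
  have h3 : descent γ₁ γ₂ v ≤ inner ℝ (denoised Ψ P v) v := hD v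
  have h4 := mul_le_mul_of_nonneg_left h3 hα
  have h5 := mul_le_mul_of_nonneg_left hv hα
  -- Young's inequality splits the bias term α‖v‖b into α²‖v‖²/2 + b²/2. The second part is
  -- compensated explicitly; the first, with Hoeffding's α²C²‖v‖²/2, is at most half of α times the
  -- descent by `h5`.
  have h6 := sq_nonneg (α * ‖v‖ - batchBias p σ K t)
  have h7 : 0 ≤ (α * C * ‖v‖) ^ 2 := sq_nonneg _
  generalize batchBias p σ K t = b at *
  generalize inner ℝ (denoised Ψ P v) v = r at *
  linarith

section run

variable {Ξ : Type*} {f : Vec d → Ξ → ℝ} {F : Vec d → ℝ} {y : Vec d}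
variable {x₁ : Vec d} {ξ : ℕ → ℕ → Ω → Ξ} {x : ℕ → Ω → Vec d} {a L γ₁ γ₂ : ℝ}

set_option maxHeartbeats 1000000 in
/-- The exponential of the compensated cost is a supermartingale. -/
theorem IsRun.lintegral_exp_potential_le [IsProbabilityMeasure μ]
    (hrun : IsRun f Ψ p a (1 / 2) x₁ y ξ x)
    (hN : IIDNoise μ f F P p y ξ x) (hP : NoiseDensity P p σ) (hΨ : SmoothNonlinearity Ψ C K)
    (hD : IsDescentPair Ψ P γ₁ γ₂) (hF : SmoothCost F L) (hp : 1 < p) (hp2 : p ≤ 2) (hσ : 0 < σ)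
    (hC : 0 < C) (hK : 0 ≤ K) (hL : 0 < L) (ha : 0 < a)
    (hmax : a ≤ maxStep (1 / 2) γ₁ γ₂ C L ‖gradient F x₁‖) (t : ℕ) :
    ∫⁻ ω, ENNReal.ofReal (Real.exp (potential F γ₁ γ₂ (stepSize a (1 / 2))
      (stepError p σ C K L a) (fun k => x k ω) t)) ∂μ ≤ 1 := by
  have hΨc := hΨ.continuous hK
  have hF' := hF.continuous_gradient hL.le
  have hFc := hF.differentiable.continuous
  induction t with
  | zero => simp [potential]
  | succ t ih =>
    set α := stepSize a (1 / 2) with hα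
    set c := stepError p σ C K L a with hc
    set B := batchSize p (t + 1) with hB
    set b := batchBias p σ K (t + 1) with hb
    have ht : 1 ≤ t + 1 := by omega
    have hα0 : 0 ≤ α (t + 1) := by
      rw [hα, stepSize]
      positivity
    set h : (ℕ → Vec d) → ENNReal := fun u =>
      ENNReal.ofReal (Real.exp (potential F γ₁ γ₂ α c u t)) with hh
    set e : Vec d → ℝ := fun v => α (t + 1) * descent γ₁ γ₂ v / 2 - b ^ 2 / 2 with he
    -- The one-step factor: it sees the past only through the latest model, and the rest of its
    -- input is fresh noise.
    set k : (ℕ → Vec d) × (ℕ → Vec d) → ENNReal := fun w =>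
      ENNReal.ofReal (Real.exp (-α (t + 1) * inner ℝ (gradient F (w.1 (t + 1)))
        (noisyDirection Ψ B (gradient F (w.1 (t + 1))) w.2)))
      * ENNReal.ofReal (Real.exp (e (gradient F (w.1 (t + 1))))) with hk
    have hgm : Measurable fun w : (ℕ → Vec d) × (ℕ → Vec d) => gradient F (w.1 (t + 1)) :=
      hF'.measurable.comp ((measurable_pi_apply _).comp measurable_fst)
    have hem : Measurable e :=
      (((continuous_descent γ₁ γ₂).measurable.const_mul _).div_const 2).sub_const _
    have hdm : Measurable fun w : (ℕ → Vec d) × (ℕ → Vec d) =>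
        noisyDirection Ψ B (gradient F (w.1 (t + 1))) w.2 :=
      (measurable_noisyDirection hΨc B).comp (hgm.prodMk measurable_snd)
    have hkm : Measurable k :=
      (((hgm.inner hdm).const_mul _).exp.ennreal_ofReal).mul (hem.comp hgm).exp.ennreal_ofReal
    have hhm : Measurable h :=
      (measurable_potential hFc hF' γ₁ γ₂ α c t).exp.ennreal_ofReal
    have hpast' : ∀ ω, pastSeq x (t + 1) ω (t + 1) = x (t + 1) ω := fun ω =>
      extendZero_restrict (fun k => x k ω) (Finset.mem_Icc.2 ⟨ht, le_rfl⟩)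
    have hgrad : ∀ᵐ u ∂μ.map (pastSeq x (t + 1)),
        α (t + 1) * ((1 + 8 * C ^ 2) * ‖gradient F (u (t + 1))‖ ^ 2)
          ≤ descent γ₁ γ₂ (gradient F (u (t + 1))) := by
      have hgm' : Measurable fun u : ℕ → Vec d => gradient F (u (t + 1)) :=
        hF'.measurable.comp (measurable_pi_apply _)
      have hdm' : Measurable fun u : ℕ → Vec d => descent γ₁ γ₂ (gradient F (u (t + 1))) :=
        (continuous_descent γ₁ γ₂).measurable.comp hgm'
      rw [ae_map_iff (hrun.aemeasurable_pastSeq hN hP hΨc hF' (t + 1))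
        (measurableSet_le (((hgm'.norm.pow_const 2).const_mul _).const_mul _) hdm')]
      refine Filter.Eventually.of_forall fun ω => ?_
      rw [hpast']
      exact hrun.stepSize_mul_sq_le hΨ.bounded hC hF hL ha hmax ht ω
    have hle : ∀ᵐ u ∂μ.map (pastSeq x (t + 1)),
        ∫⁻ ω, k (u, noiseSeq f F p y ξ x (t + 1) ω) ∂μ ≤ 1 := by
      filter_upwards [hgrad] with u hu
      have h2 : ∀ ω, noisyDirection Ψ B (gradient F (u (t + 1)))
            (noiseSeq f F p y ξ x (t + 1) ω)
          = noisyDirection Ψ B (gradient F (u (t + 1))) fun j =>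
            gradNoise f F y (x (t + 1) ω) (fun i => ξ (t + 1) i ω) j := fun ω =>
        noisyDirection_congr fun j hj => extendZero_restrict
          (gradNoise f F y (x (t + 1) ω) fun i => ξ (t + 1) i ω) hj
      simp only [hk, h2]
      exact lintegral_exp_step_le_one hΨ hK hP hp hp2 hσ hD ht (hN.law (t + 1) ht)
        (fun i hi j hj hij => (hN.indep (t + 1) ht).indepFun (i := ⟨i, hi⟩) (j := ⟨j, hj⟩)
          (by simpa using hij)) _ hα0 hu
    have hbound := lintegral_mul_le_of_indepFun (hN.indepFun_pastSeq ht)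
      (hrun.aemeasurable_pastSeq hN hP hΨc hF' (t + 1)) (hN.aemeasurable_noiseSeq hP ht)
      hhm hkm hle
    have hpast : ∀ ω, potential F γ₁ γ₂ α c (pastSeq x (t + 1) ω) t
        = potential F γ₁ γ₂ α c (fun k => x k ω) t := fun ω =>
      potential_congr _ _ _ _ _ fun k hk => extendZero_restrict (fun k => x k ω) hk
    simp only [hh, hk, hpast, hpast'] at hbound
    refine (lintegral_mono fun ω => ?_).trans (hbound.trans ih)
    rw [← ENNReal.ofReal_mul (Real.exp_pos _).le, ← Real.exp_add,
      ← ENNReal.ofReal_mul (Real.exp_pos _).le, ← Real.exp_add]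
    refine ENNReal.ofReal_le_ofReal (Real.exp_le_exp.2 ?_)
    rw [potential_succ_sub]
    have h1 := hrun.step_eq_noiseSeq (F := F) ht ω
    have h2 := hF.sub_smul_le hL.le (x (t + 1) ω) hα0 (norm_noisyDirection_le hΨ.bounded B
      (gradient F (x (t + 1) ω)) (noiseSeq f F p y ξ x (t + 1) ω))
    have h3 : F (x (t + 2) ω) = F (x (t + 1) ω - α (t + 1) • noisyDirection Ψ B
      (gradient F (x (t + 1) ω)) (noiseSeq f F p y ξ x (t + 1) ω)) := congrArg F h1
    have h5 : c (t + 1) = b ^ 2 / 2 + L * (α (t + 1) * C) ^ 2 := rfl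
    simp only [he]
    rw [h5, h3]
    linarith

end run

end

/-! ### Rates, the number of iterations, and Markov's inequality -/

section

section rates

variable {p σ C K L a : ℝ}

/-- The batch exponent p/(2(p-1)) is the one for which B_t^(-(p-1)/p) ≤ t^(-1/2), so the squared
bias has the same order 1/t as α_t². -/
theorem batchBias_sq_le (hp : 1 < p) (hσ : 0 ≤ σ) (hK : 0 ≤ K) {t : ℕ} (ht : 1 ≤ t) :
    batchBias p σ K t ^ 2 ≤ 9 * K ^ 2 * σ ^ 2 / t := by
  have ht0 : (0 : ℝ) < t := by exact_mod_cast ht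
  have hp1 : 0 < p - 1 := by linarith
  have h1 : (t : ℝ) ^ (p / (2 * (p - 1))) ≤ batchSize p t := Nat.le_ceil _
  have h2 : (batchSize p t : ℝ) ^ (-((p - 1) / p)) ≤ (t : ℝ) ^ (-(1 / 2) : ℝ) := by
    calc (batchSize p t : ℝ) ^ (-((p - 1) / p))
        ≤ ((t : ℝ) ^ (p / (2 * (p - 1)))) ^ (-((p - 1) / p)) :=
          Real.rpow_le_rpow_of_nonpos (by positivity) h1
            (neg_nonpos.2 (div_nonneg hp1.le (by linarith)))
      _ = _ := by
          rw [← Real.rpow_mul ht0.le]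
          congr 1
          field_simp
  have h3 : ((t : ℝ) ^ (-(1 / 2) : ℝ)) ^ 2 = 1 / t := by
    rw [Real.rpow_neg ht0.le, ← Real.sqrt_eq_rpow, inv_pow, Real.sq_sqrt ht0.le, one_div]
  calc batchBias p σ K t ^ 2 ≤ (K * (3 * σ * (t : ℝ) ^ (-(1 / 2) : ℝ))) ^ 2 := by
        unfold batchBias
        gcongr
    _ = 9 * K ^ 2 * σ ^ 2 * ((t : ℝ) ^ (-(1 / 2) : ℝ)) ^ 2 := by ring
    _ = _ := by rw [h3]; ring

theorem stepError_le (hp : 1 < p) (hσ : 0 ≤ σ) (hK : 0 ≤ K) (hL : 0 ≤ L) {t : ℕ} (ht : 1 ≤ t) :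
    stepError p σ C K L a t ≤ (9 * K ^ 2 * σ ^ 2 / 2 + L * a ^ 2 * C ^ 2) * (t : ℝ)⁻¹ := by
  have ht0 : (0 : ℝ) < t := by exact_mod_cast ht
  have h1 := batchBias_sq_le hp hσ hK ht
  have h2 : (stepSize a (1 / 2) t * C) ^ 2 ≤ a ^ 2 * C ^ 2 / t := by
    rw [stepSize_half, mul_pow, div_pow, Real.sq_sqrt (by positivity), div_mul_eq_mul_div]
    gcongr
    linarith
  have h3 := mul_le_mul_of_nonneg_left h2 hL
  calc stepError p σ C K L a t
      ≤ 9 * K ^ 2 * σ ^ 2 / t / 2 + L * (a ^ 2 * C ^ 2 / t) := by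
        unfold stepError
        linarith
    _ = _ := by ring

theorem sum_stepError_le (hp : 1 < p) (hσ : 0 ≤ σ) (hK : 0 ≤ K) (hL : 0 ≤ L) (T : ℕ) :
    ∑ t ∈ Finset.Icc 1 T, stepError p σ C K L a t
      ≤ (9 * K ^ 2 * σ ^ 2 / 2 + L * a ^ 2 * C ^ 2) * (1 + Real.log T) := by
  calc _ ≤ ∑ t ∈ Finset.Icc 1 T, (9 * K ^ 2 * σ ^ 2 / 2 + L * a ^ 2 * C ^ 2) * (t : ℝ)⁻¹ :=
        Finset.sum_le_sum fun t ht => stepError_le hp hσ hK hL (Finset.mem_Icc.1 ht).1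
    _ ≤ _ := by
        rw [← Finset.mul_sum]
        refine mul_le_mul_of_nonneg_left ?_ (by positivity)
        have := harmonic_le_one_add_log T
        rw [harmonic_eq_sum_Icc] at this
        push_cast at this
        exact this

theorem le_sum_stepSize (ha : 0 ≤ a) {T : ℕ} (hT : 1 ≤ T) :
    a * √T / 2 ≤ ∑ t ∈ Finset.Icc 1 T, stepSize a (1 / 2) t := by
  have hT0 : (1 : ℝ) ≤ T := by exact_mod_cast hT
  have hs : 0 < √((T : ℝ) + 1) := by positivity
  calc a * √T / 2 ≤ T * (a / √((T : ℝ) + 1)) := by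
        have h1 : √((T : ℝ) + 1) ≤ 2 * √T := by
          rw [Real.sqrt_le_left (by positivity), mul_pow, Real.sq_sqrt (by positivity)]
          linarith
        rw [mul_div_assoc', le_div_iff₀ hs]
        have h2 := mul_le_mul_of_nonneg_left h1 (show 0 ≤ a * √T / 2 by positivity)
        have h3 : a * √T / 2 * (2 * √T) = a * (√T * √T) := by ring
        rw [h3, Real.mul_self_sqrt (by positivity)] at h2
        linarith
    _ = ∑ _t ∈ Finset.Icc 1 T, a / √((T : ℝ) + 1) := by
        rw [Finset.sum_const, Nat.card_Icc, Nat.add_sub_cancel, nsmul_eq_mul]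
    _ ≤ _ := Finset.sum_le_sum fun t ht => by
        have ht' : (t : ℝ) ≤ T := by exact_mod_cast (Finset.mem_Icc.1 ht).2
        rw [stepSize_half]
        gcongr

theorem oracleCalls_le (hp : 1 < p) {T : ℕ} (hT : 1 ≤ T) :
    (oracleCalls p T : ℝ) ≤ 4 * (T : ℝ) ^ ((3 * p - 2) / (p - 1) / 2) := by
  have hp1 : 0 < p - 1 := by linarith
  set q := p / (2 * (p - 1)) with hq
  have hq0 : 0 ≤ q := by positivity
  have hT0 : (1 : ℝ) ≤ T := by exact_mod_cast hT
  have h1 : (1 : ℝ) ≤ (T : ℝ) ^ q := Real.one_le_rpow hT0 hq0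
  have h2 : ∀ t ∈ Finset.Icc 1 T, (batchSize p t : ℝ) + 2 ≤ 4 * (T : ℝ) ^ q := fun t ht => by
    have h3 : (batchSize p t : ℝ) < (t : ℝ) ^ q + 1 := Nat.ceil_lt_add_one (by positivity)
    have h4 : (t : ℝ) ^ q ≤ (T : ℝ) ^ q :=
      Real.rpow_le_rpow (by positivity) (by exact_mod_cast (Finset.mem_Icc.1 ht).2) hq0
    linarith
  have h5 : (3 * p - 2) / (p - 1) / 2 = 1 + q := by
    rw [hq]
    field_simp
    ring
  unfold oracleCalls
  push_cast
  calc _ ≤ ∑ _t ∈ Finset.Icc 1 T, 4 * (T : ℝ) ^ q := Finset.sum_le_sum h2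
    _ = _ := by
        rw [Finset.sum_const, Nat.card_Icc, Nat.add_sub_cancel, nsmul_eq_mul, h5,
          Real.rpow_add (by linarith), Real.rpow_one]
        ring

set_option maxHeartbeats 1000000 in
/-- The number of iterations after which the accumulated descent beats the accumulated error. -/
theorem exists_iterations_bound {γ a c ε₀ : ℝ} (Δ : ℝ) (hγ : 0 < γ) (ha : 0 < a) (hc : 0 ≤ c)
    (hε₀ : 0 < ε₀) :
    ∃ D : ℝ, 1 ≤ D ∧ ∀ ε δ : ℝ, 0 < ε → ε ≤ ε₀ → 0 < δ → δ < 1 →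
      ∀ T : ℕ, T = ⌈(D * (Real.log (2 + 1 / (ε * δ)) / ε ^ 2)) ^ 2⌉₊ →
        Real.log (1 / δ) + Δ + c * (1 + Real.log T) ≤ γ * ε ^ 2 * (a * √T / 4) := by
  set k := γ * a / 4 with hk
  have hk0 : 0 < k := by positivity
  have hl0 : 0 ≤ Real.log (1 + ε₀) := Real.log_nonneg (by linarith)
  set k₁ := 2 * Real.log (1 + ε₀) + 1 + 2 * |Δ| + 10 * c with hk₁
  have hk₁0 : 0 ≤ k₁ := by positivity
  -- T depends on D, so log T reappears on the left-hand side. With D = n² it grows at most linearly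
  -- in n, while the right-hand side grows like kn²l; this n is large enough for the quadratic to
  -- win.
  set n := 1 + (k₁ + 8 * c) / k with hn
  have hn1 : 1 ≤ n := le_add_of_nonneg_right (by positivity)
  have hkn : k * n = k + k₁ + 8 * c := by
    rw [hn]
    field_simp
    ring
  have hkn2 : k₁ + 8 * c * n ≤ k * n ^ 2 := by
    have : k * n ^ 2 = (k + k₁ + 8 * c) * n := by rw [← hkn]; ring
    nlinarith
  have hD1 : 1 ≤ n ^ 2 := one_le_pow₀ hn1
  refine ⟨n ^ 2, hD1, fun ε δ hε hεε₀ hδ hδ1 T hT => ?_⟩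
  set u := 2 + 1 / (ε * δ) with hu
  set l := Real.log u with hl
  have hinv : 0 < 1 / (ε * δ) := by positivity
  have hu2 : 2 ≤ u := by linarith
  have hlhalf : 1 / 2 ≤ l := by
    have h1 : Real.log 2 ≤ l := Real.log_le_log (by norm_num) hu2
    linarith [Real.log_two_gt_d9]
  have hlu : l ≤ u := Real.log_le_self (by linarith)
  have hεu : 1 / ε ≤ u := by
    have : 1 / ε = δ * (1 / (ε * δ)) := by field_simp
    nlinarith
  have hδu : 1 / δ ≤ (1 + ε₀) * u := by
    have : 1 / δ = ε * (1 / (ε * δ)) := by field_simp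
    nlinarith
  -- The upper bound ε₀ on ε is what allows log(1/δ) to be controlled by log(2 + 1/(εδ)).
  have hlogδ : Real.log (1 / δ) ≤ Real.log (1 + ε₀) + l := by
    rw [hl, ← Real.log_mul (by positivity) (by positivity)]
    exact Real.log_le_log (by positivity) hδu
  set R := l / ε ^ 2 with hR
  have hR0 : 0 < R := by positivity
  have hRu : R ≤ u ^ 3 := by
    have : R = l * (1 / ε) ^ 2 := by rw [hR]; ring
    rw [this]
    calc l * (1 / ε) ^ 2 ≤ u * u ^ 2 := by gcongr
      _ = u ^ 3 := by ring
  have hTle : (T : ℝ) ≤ (n ^ 2 * R) ^ 2 + 1 := by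
    rw [hT]
    exact (Nat.ceil_lt_add_one (by positivity)).le
  have hTge : (n ^ 2 * R) ^ 2 ≤ T := by
    rw [hT]
    exact Nat.le_ceil _
  have hT0 : (0 : ℝ) < T := lt_of_lt_of_le (by positivity) hTge
  have hlogT : Real.log T ≤ 1 + 4 * n + 6 * l := by
    have h1 : (T : ℝ) ≤ 2 * n ^ 4 * u ^ 6 := by
      have h2 : (n ^ 2 * R) ^ 2 ≤ (n ^ 2 * u ^ 3) ^ 2 := by gcongr
      have h3 : 1 ≤ (n ^ 2 * u ^ 3) ^ 2 :=
        one_le_pow₀ (one_le_mul_of_one_le_of_one_le hD1 (one_le_pow₀ (by linarith)))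
      calc (T : ℝ) ≤ (n ^ 2 * u ^ 3) ^ 2 + (n ^ 2 * u ^ 3) ^ 2 := by linarith
        _ = _ := by ring
    have h2 := Real.log_le_log hT0 h1
    rw [Real.log_mul (by positivity) (by positivity), Real.log_mul (by positivity) (by positivity),
      Real.log_pow, Real.log_pow] at h2
    have h3 : Real.log n ≤ n := Real.log_le_self (by linarith)
    have h4 : Real.log 2 ≤ 1 := by linarith [Real.log_two_lt_d9]
    push_cast at h2
    linarith
  have hsqrt : n ^ 2 * R ≤ √T := Real.le_sqrt_of_sq_le hTge
  have hmain : k * n ^ 2 * l ≤ γ * ε ^ 2 * (a * √T / 4) := by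
    have h1 : ε ^ 2 * R = l := by rw [hR]; field_simp
    calc k * n ^ 2 * l = γ * ε ^ 2 * (a * (n ^ 2 * R) / 4) := by rw [← h1, hk]; ring
      _ ≤ _ := by gcongr
  refine le_trans ?_ hmain
  have h1 : c * (1 + Real.log T) ≤ c * (2 + 4 * n + 6 * l) :=
    mul_le_mul_of_nonneg_left (by linarith) hc
  have h2 : (k₁ + 8 * c * n) * l ≤ k * n ^ 2 * l :=
    mul_le_mul_of_nonneg_right hkn2 (by linarith)
  refine le_trans ?_ h2
  -- Since 2l ≥ 1, all constants are absorbed into multiples of l.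
  have h3 : 0 ≤ (2 * l - 1) * (Real.log (1 + ε₀) + |Δ| + 2 * c + 4 * (c * n)) :=
    mul_nonneg (by linarith) (by positivity)
  have h4 : (k₁ + 8 * c * n) * l
      = l + 6 * c * l + 2 * l * (Real.log (1 + ε₀) + |Δ| + 2 * c + 4 * (c * n)) := by
    rw [hk₁]
    ring
  rw [h4]
  linarith [le_abs_self Δ]

end rates

variable {d : ℕ} {P : Vec d → ℝ} {p σ : ℝ}
variable {Ω : Type*} [MeasurableSpace Ω] {μ : Measure Ω} {Ψ : Vec d → Vec d} {C K : ℝ}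
variable {Ξ : Type*} {f : Vec d → Ξ → ℝ} {F : Vec d → ℝ} {y : Vec d}
variable {x₁ : Vec d} {ξ : ℕ → ℕ → Ω → Ξ} {x : ℕ → Ω → Vec d} {a L γ₁ γ₂ : ℝ}

theorem SmoothCost.nonneg_of_sub_iInf_le (hF : SmoothCost F L) {Δ : ℝ}
    (hΔ : F x₁ - ⨅ w, F w ≤ Δ) (w : Vec d) : -Δ ≤ F w - F x₁ := by
  linarith [ciInf_le hF.bddBelow w]

/-- A run visits an `ε`-stationary point with probability at least `1 - δ` as soon as the guaranteed
descent over `T` iterations beats the accumulated error. -/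
theorem IsRun.one_sub_le_measure_stationary [IsProbabilityMeasure μ]
    (hrun : IsRun f Ψ p a (1 / 2) x₁ y ξ x)
    (hN : IIDNoise μ f F P p y ξ x) (hP : NoiseDensity P p σ) (hΨ : SmoothNonlinearity Ψ C K)
    (hD : IsDescentPair Ψ P γ₁ γ₂) (hF : SmoothCost F L) (hp : 1 < p) (hp2 : p ≤ 2) (hσ : 0 < σ)
    (hC : 0 < C) (hK : 0 ≤ K) (hL : 0 < L) (ha : 0 < a) (hγ₁ : 0 < γ₁) (hγ₂ : 0 < γ₂)
    (hmax : a ≤ maxStep (1 / 2) γ₁ γ₂ C L ‖gradient F x₁‖) {Δ : ℝ}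
    (hΔ : F x₁ - ⨅ w, F w ≤ Δ) {ε δ : ℝ} (hε : 0 < ε) (hδ : 0 < δ) {T : ℕ} (hT : 1 ≤ T)
    (hbig : Real.log (1 / δ) + Δ
      + (9 * K ^ 2 * σ ^ 2 / 2 + L * a ^ 2 * C ^ 2) * (1 + Real.log T)
        ≤ min (γ₁ * ε) (γ₂ * ε ^ 2) * (a * √T / 4)) :
    ENNReal.ofReal (1 - δ) ≤ μ {ω | ∃ k ∈ Finset.Icc 1 T, ‖gradient F (x k ω)‖ ≤ ε} := by
  set good := {ω | ∃ k ∈ Finset.Icc 1 T, ‖gradient F (x k ω)‖ ≤ ε} with hgood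
  set pot : Ω → ℝ := fun ω => potential F γ₁ γ₂ (stepSize a (1 / 2))
    (stepError p σ C K L a) (fun k => x k ω) T with hpot
  have hlow : ∀ ω ∈ goodᶜ, Real.log (1 / δ) ≤ pot ω := by
    intro ω hω
    have hω' : ∀ k ∈ Finset.Icc 1 T, ε < ‖gradient F (x k ω)‖ := fun k hk => by
      by_contra! hcon
      exact hω ⟨k, hk, hcon⟩
    set m := min (γ₁ * ε) (γ₂ * ε ^ 2) with hm
    have hm0 : 0 ≤ m := by positivity
    have h1 : ∀ k ∈ Finset.Icc 1 T, stepSize a (1 / 2) k * (m / 2)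
        ≤ stepSize a (1 / 2) k * descent γ₁ γ₂ (gradient F (x k ω)) / 2 := fun k hk => by
      have h2 : m ≤ descent γ₁ γ₂ (gradient F (x k ω)) := by
        have h3 := (hω' k hk).le
        unfold descent
        rw [hm]
        gcongr
      have h4 : 0 ≤ stepSize a (1 / 2) k := by
        rw [stepSize]
        positivity
      rw [mul_div_assoc]
      gcongr
    have h2 := Finset.sum_le_sum h1
    rw [← Finset.sum_mul] at h2
    have h3 := mul_le_mul_of_nonneg_right (le_sum_stepSize ha.le hT) (show 0 ≤ m / 2 by positivity)
    have h4 := sum_stepError_le (C := C) (a := a) hp hσ.le hK hL.le T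
    have h5 := hF.nonneg_of_sub_iInf_le hΔ (x (T + 1) ω)
    simp only [hpot, potential]
    rw [Finset.sum_sub_distrib, hrun.init]
    linarith
  have hE := hrun.lintegral_exp_potential_le hN hP hΨ hD hF hp hp2 hσ hC hK hL ha hmax T
  have hpm : AEMeasurable pot μ := by
    have h1 := (measurable_potential hF.differentiable.continuous (hF.continuous_gradient hL.le)
      γ₁ γ₂ (stepSize a (1 / 2)) (stepError p σ C K L a) T).comp_aemeasurable
      (hrun.aemeasurable_pastSeq hN hP (hΨ.continuous hK) (hF.continuous_gradient hL.le) (T + 1))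
    refine h1.congr (Filter.Eventually.of_forall fun ω => ?_)
    exact potential_congr _ _ _ _ _ fun k hk => extendZero_restrict (fun k => x k ω) hk
  have hbad : μ goodᶜ ≤ ENNReal.ofReal δ := by
    -- Markov's inequality for the exponential of the potential, which is at least 1/δ on the bad
    -- event by `hlow`.
    have h1 := mul_meas_ge_le_lintegral₀ hpm.exp.ennreal_ofReal (ENNReal.ofReal (1 / δ))
    have h2 : μ goodᶜ ≤ μ {ω | ENNReal.ofReal (1 / δ) ≤ ENNReal.ofReal (Real.exp (pot ω))} := by
      refine measure_mono fun ω hω => ENNReal.ofReal_le_ofReal ?_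
      rw [← Real.exp_log (show 0 < 1 / δ by positivity)]
      exact Real.exp_le_exp.2 (hlow ω hω)
    have h3 : ENNReal.ofReal (1 / δ) * μ goodᶜ ≤ 1 :=
      (mul_le_mul_right h2 _).trans (h1.trans hE)
    calc μ goodᶜ = ENNReal.ofReal δ * (ENNReal.ofReal (1 / δ) * μ goodᶜ) := by
          rw [← mul_assoc, ← ENNReal.ofReal_mul hδ.le, mul_one_div_cancel hδ.ne',
            ENNReal.ofReal_one, one_mul]
      _ ≤ ENNReal.ofReal δ * 1 := mul_le_mul_right h3 _
      _ = _ := mul_one _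
  have htot : 1 ≤ μ good + μ goodᶜ := by
    rw [← measure_univ (μ := μ), ← Set.union_compl_self good]
    exact measure_union_le _ _
  rw [ENNReal.ofReal_sub _ hδ.le, ENNReal.ofReal_one]
  exact tsub_le_iff_right.2 (htot.trans (add_le_add le_rfl hbad))

end

end NMSGE

end

theorem mainTheorem11
    (p σ C K L Δ a γ₁ γ₂ ε₀ : ℝ)
    (hp : 1 < p) (hp2 : p ≤ 2) (hσ : 0 < σ) (hC : 0 < C) (hK : 0 < K) (hL : 0 < L)
    (ha : 0 < a) (hγ₁ : 0 < γ₁) (hγ₂ : 0 < γ₂) (hε₀ : 0 < ε₀) :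
    (∀ (d : ℕ) (Ψ : NMSGE.Vec d → NMSGE.Vec d) (P : NMSGE.Vec d → ℝ),
      NMSGE.SmoothNonlinearity Ψ C K → NMSGE.NoiseDensity P p σ →
      ∃ g₁ > 0, ∃ g₂ > 0, NMSGE.IsDescentPair Ψ P g₁ g₂) ∧
    ∃ A > 0,
      ∀ (d : ℕ) (Ψ : NMSGE.Vec d → NMSGE.Vec d) (P : NMSGE.Vec d → ℝ)
        (Ω : Type*) [MeasurableSpace Ω] (μ : MeasureTheory.Measure Ω)
        [MeasureTheory.IsProbabilityMeasure μ]
        (Ξ : Type*) [MeasurableSpace Ξ] (ν : MeasureTheory.Measure Ξ)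
        [MeasureTheory.IsProbabilityMeasure ν]
        (f : NMSGE.Vec d → Ξ → ℝ) (F : NMSGE.Vec d → ℝ) (x₁ y : NMSGE.Vec d)
        (ξ : ℕ → ℕ → Ω → Ξ) (x : ℕ → Ω → NMSGE.Vec d),
      NMSGE.SmoothNonlinearity Ψ C K →
      NMSGE.NoiseDensity P p σ →
      NMSGE.IsDescentPair Ψ P γ₁ γ₂ →
      NMSGE.IsPopulationCost f ν F →
      NMSGE.SmoothCost F L →
      F x₁ - ⨅ w, F w ≤ Δ →
      a ≤ NMSGE.maxStep (1 / 2) γ₁ γ₂ C L ‖gradient F x₁‖ →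
      NMSGE.IIDSamples μ ν ξ →
      NMSGE.IsRun f Ψ p a (1 / 2) x₁ y ξ x →
      NMSGE.IIDNoise μ f F P p y ξ x →
      ∀ ε δ : ℝ, 0 < ε → ε ≤ ε₀ → 0 < δ → δ < 1 →
        ∃ T : ℕ,
          (NMSGE.oracleCalls p T : ℝ)
            ≤ A * ε ^ (-((6 * p - 4) / (p - 1)))
              * Real.log (2 + 1 / (ε * δ)) ^ ((3 * p - 2) / (p - 1)) ∧
          ENNReal.ofReal (1 - δ)
            ≤ μ {ω | ∃ k ∈ Finset.Icc 1 T, ‖gradient F (x k ω)‖ ≤ ε} := by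
  have hp1 : 0 < p - 1 := by linarith
  refine ⟨fun d Ψ P hΨ hP => hΨ.exists_isDescentPair hK.le hP, ?_⟩
  -- For ε ≤ ε₀ this gives γε² ≤ min(γ₁ε, γ₂ε²), so the quadratic regime alone has to be treated.
  set γ : ℝ := min (γ₁ / ε₀) γ₂ with hγ
  have hγ0 : 0 < γ := by positivity
  obtain ⟨D, hD1, hD⟩ := NMSGE.exists_iterations_bound
    (c := 9 * K ^ 2 * σ ^ 2 / 2 + L * a ^ 2 * C ^ 2) Δ hγ0 ha (by positivity) hε₀
  set s : ℝ := (3 * p - 2) / (p - 1) with hs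
  have hs0 : 0 < s := div_pos (by linarith) hp1
  -- D² comes from T ≈ (DR)². The term 4ε₀⁴ absorbs the rounding of T, because l ≥ 1/2 and ε ≤ ε₀
  -- force R ≥ 1/(2ε₀²).
  refine ⟨4 * (D ^ 2 + 4 * ε₀ ^ 4) ^ (s / 2), by positivity, ?_⟩
  intro d Ψ P Ω _ μ _ Ξ _ ν _ f F x₁ y ξ x hΨ hP hdesc _ hF hΔ hmax _ hrun hN ε δ hε hεε₀ hδ hδ1
  set l := Real.log (2 + 1 / (ε * δ)) with hl
  have hlhalf : 1 / 2 ≤ l := by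
    have h1 : Real.log 2 ≤ l :=
      Real.log_le_log (by norm_num) (le_add_of_nonneg_right (by positivity))
    linarith [Real.log_two_gt_d9]
  set R := l / ε ^ 2 with hR
  have hR0 : 0 < R := by positivity
  set T := ⌈(D * R) ^ 2⌉₊ with hT
  have hT1 : 1 ≤ T := Nat.one_le_ceil_iff.2 (by positivity)
  refine ⟨T, ?_, ?_⟩
  · have hR1 : 1 ≤ 4 * ε₀ ^ 4 * R ^ 2 := by
      have h1 : 1 ≤ 2 * ε₀ ^ 2 * R := by
        rw [hR, mul_div_assoc', le_div_iff₀ (by positivity)]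
        have h2 : ε ^ 2 ≤ ε₀ ^ 2 := by gcongr
        nlinarith [sq_nonneg ε₀]
      calc (1 : ℝ) ≤ (2 * ε₀ ^ 2 * R) ^ 2 := one_le_pow₀ h1
        _ = _ := by ring
    have hTle : (T : ℝ) ≤ (D ^ 2 + 4 * ε₀ ^ 4) * R ^ 2 := by
      have h1 : (T : ℝ) < (D * R) ^ 2 + 1 := Nat.ceil_lt_add_one (by positivity)
      linarith
    have hRs : (R ^ 2) ^ (s / 2) = ε ^ (-((6 * p - 4) / (p - 1))) * l ^ s := by
      have h1 : -((6 * p - 4) / (p - 1)) = (-2) * s := by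
        rw [hs]
        field_simp
        ring
      rw [← Real.rpow_natCast, ← Real.rpow_mul hR0.le, h1, Real.rpow_mul hε.le,
        ← Real.mul_rpow (by positivity) (by positivity)]
      congr 1
      · rw [hR, Real.rpow_neg hε.le, Real.rpow_two]
        ring
      · push_cast
        ring
    calc (NMSGE.oracleCalls p T : ℝ) ≤ 4 * (T : ℝ) ^ (s / 2) := NMSGE.oracleCalls_le hp hT1
      _ ≤ 4 * ((D ^ 2 + 4 * ε₀ ^ 4) * R ^ 2) ^ (s / 2) := by gcongr
      _ = _ := by
          rw [Real.mul_rpow (by positivity) (by positivity), hRs]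
          ring
  · refine hrun.one_sub_le_measure_stationary hN hP hΨ hdesc hF hp hp2 hσ hC hK.le hL ha hγ₁ hγ₂
      hmax hΔ hε hδ hT1 ((hD ε δ hε hεε₀ hδ hδ1 T hT).trans ?_)
    refine mul_le_mul_of_nonneg_right (le_min ?_ ?_) (by positivity)
    · have h1 : γ ≤ γ₁ / ε₀ := min_le_left _ _
      calc γ * ε ^ 2 ≤ γ₁ / ε₀ * (ε₀ * ε) := by
            rw [pow_two]
            gcongr
        _ = γ₁ * ε := by field_simp
    · exact mul_le_mul_of_nonneg_right (min_le_right _ _) (by positivity)
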